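/- Let $a,b,c,d$ be the consecutive vertices of a nondegenerate rectangle in $\mathbb R^2$, and let $S$ be a finite set of closed, non-vertical, nondegenerate line segments that contains the four sides of the rectangle and whose other elements are pairwise disjoint and contained in the interior of the rectangle. Two points are mutually visible if the open segment between them meets no element of $S$. A segment $s\in S$ is visible from a point $p$ if some point of $s$ and $p$ are mutually visible. For $s\in S$ the triangle covering $C_S(s)$ is obtained by sweeping a point $x$ from left to right along $s$. It consists of the following triangles above the line containing $s$, together with the triangles below this line that are obtained in the same way after a reflection in a horizontal line (again sweeping from left to right). (i) Initial triangles. Let $\ell$ be the left endpoint of $s$. For each $t\in S$ and each maximal open subsegment $(w_1,w_2)$ of $t$ that lies strictly above the line containing $s$ and all of whose points are visible from $\ell$, the triangle $\ell w_1w_2$. (ii) Sweep triangles. Let $q$ be an endpoint of an element of $S$ with other endpoint $u$, and let $t\in S$. Say that there is an active edge from $q$ to $t$ at $x\in s$ if $q$ is strictly above the line containing $s$, $q$ is visible from $x$, $u$ lies strictly to the left of the ray from $x$ through $q$, and the first point other than $q$ of an element of $S$ that is met when this ray is followed beyond $q$ exists and lies on $t$. For each maximal open subsegment $(x_1,x_2)$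 of $s$ at all of whose points there is an active edge from $q$ to $t$, the triangle $qw_1w_2$, where $w_i$ is the point of $t$ on the line through $x_i$ and $q$, beyond $q$. Let $C(S)=\bigcup_{s\in S}C_S(s)$, as a family: a triangle that belongs to $C_S(s)$ for several $s$ occurs once for each such $s$. Let $p$ be a point in the interior of the rectangle that is not on the boundary of any triangle in $C(S)$. Let $m_p$ be the number of segments of $S$ visible from $p$ and $m'_p$ the number of triangles of $C(S)$ that contain $p$. Then $$m_p\le m'_p\le 2m_p .$$ Moreover, there is a map from the triangles of $C(S)$ that contain $p$ to the segments of $S$ visible from $p$ under which each segment is the image of at most two triangles. -/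

import Mathlib

namespace SegVis

/-- The Euclidean plane, in coordinates. Only its affine and topological structure is used;
the right angles of the bounding rectangle are written out in coordinates. -/
abbrev Plane : Type := ℝ × ℝ

/-- The determinant of two plane vectors: positive iff `v` points to the left of `u`. -/
def cross (u v : Plane) : ℝ := u.1 * v.2 - u.2 * v.1

/-- A closed, non-vertical line segment, given by its left and its right endpoint. -/
structure Seg where
  left : Plane
  right : Plane
  lt : left.1 < right.1

namespace Seg

/-- The closed segment as a set of points. -/
def carrier (s : Seg) : Set Plane := segment ℝ s.left s.right

/-- The point of `s` with parameter `r`: `left` for `r = 0`, `right` for `r = 1`. -/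
def pt (s : Seg) (r : ℝ) : Plane := s.left + r • (s.right - s.left)

/-- `q` is strictly above (`ε = 1`), respectively strictly below (`ε = -1`), the line that
contains `s`. -/
def OnSide (s : Seg) (ε : ℝ) (q : Plane) : Prop :=
  0 < ε * cross (s.right - s.left) (q - s.left)

/-- `q` is one endpoint of `s`, and `u` is the other one. -/
def HasEnds (s : Seg) (q u : Plane) : Prop :=
  (q = s.left ∧ u = s.right) ∨ (q = s.right ∧ u = s.left)

end Seg

/-- Two points are mutually visible if the open segment between them meets no element of `S`
(the open segment between a point and itself is empty). -/
def Visible (S : Finset Seg) (p q : Plane) : Prop :=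
  p = q ∨ ∀ s ∈ S, Disjoint (openSegment ℝ p q) s.carrier

/-- The segment `s` is (at least partially) visible from the point `p`. -/
def SegVisible (S : Finset Seg) (s : Seg) (p : Plane) : Prop :=
  ∃ q ∈ s.carrier, Visible S p q

/-- `(a, b)` is a maximal nonempty open subinterval of `[0, 1]` on which `P` holds. -/
def IsMaxInterval (P : ℝ → Prop) (a b : ℝ) : Prop :=
  0 ≤ a ∧ a < b ∧ b ≤ 1 ∧ (∀ r ∈ Set.Ioo a b, P r) ∧
    ∀ a' b' : ℝ, 0 ≤ a' → a' ≤ a → b ≤ b' → b' ≤ 1 → (∀ r ∈ Set.Ioo a' b', P r) →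
      a' = a ∧ b' = b

/-- The triangles added when the sweep over `s` starts, on the side `ε` of `s`. Each maximal
subsegment of an element `t` of `S` that lies on that side and is visible from the left
endpoint of `s` is an edge of the visibility polygon of this endpoint; together with the
endpoint it spans a triangle. -/
def initialTriangles (S : Finset Seg) (s : Seg) (ε : ℝ) : Set (Set Plane) :=
  {Δ | ∃ t ∈ S, ∃ a b : ℝ,
    IsMaxInterval (fun r => s.OnSide ε (t.pt r) ∧ Visible S s.left (t.pt r)) a b ∧
    Δ = convexHull ℝ {s.left, t.pt a, t.pt b}}

/-- Seen from the point `p` of `s`, there is an active edge on the side `ε` of `s` that starts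
at `q` and ends on `t`. Here `q` is an endpoint, visible from `p`, of an element of `S` whose
other endpoint is `u`; the edge runs from `q`, away from `p` on the line through `p` and `q`,
up to the first point `w` of an element of `S`, and `w` lies on `t`. For `ε = 1` the segment
`qu` is to the left of the ray from `p` through `q`, so that the visibility polygon of `p`
lies to the right of the edge and the region to its left is uncovered when `p` moves to the
right along `s`. The case `ε = -1` is the mirror image with respect to a horizontal line. -/
def ActiveEdge (S : Finset Seg) (s : Seg) (ε : ℝ) (q u : Plane) (t : Seg) (p : Plane) : Prop :=
  s.OnSide ε q ∧ Visible S p q ∧ 0 < ε * cross (q - p) (u - q) ∧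
    ∃ c : ℝ, 0 < c ∧ q + c • (q - p) ∈ t.carrier ∧ Visible S q (q + c • (q - p))

/-- The triangles generated by active edges when `p` sweeps over `s` from left to right, on the
side `ε` of `s`. While `p` moves from `s.pt a` (where the edge becomes active) to `s.pt b`
(where it ceases to exist, changes its far end `t`, or `p` reaches the right endpoint of `s`),
the edge at `q` sweeps over the triangle with vertex `q` that is bounded by the lines through `q`
and `s.pt a`, through `q` and `s.pt b`, and by the segment `t`. -/
def sweepTriangles (S : Finset Seg) (s : Seg) (ε : ℝ) : Set (Set Plane) :=
  {Δ | ∃ f ∈ S, ∃ q u : Plane, f.HasEnds q u ∧ ∃ t ∈ S, ∃ a b : ℝ,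
    IsMaxInterval (fun r => ActiveEdge S s ε q u t (s.pt r)) a b ∧
    ∃ α β : ℝ, 0 < α ∧ 0 < β ∧
      q + α • (q - s.pt a) ∈ t.carrier ∧ q + β • (q - s.pt b) ∈ t.carrier ∧
      Δ = convexHull ℝ {q, q + α • (q - s.pt a), q + β • (q - s.pt b)}}

/-- The triangle covering `C_S(s)` of the visibility region of `s`: the triangles produced by
the sweep above `s` and by the symmetric sweep below `s`, both from left to right. -/
def cover (S : Finset Seg) (s : Seg) : Set (Set Plane) :=
  (initialTriangles S s 1 ∪ sweepTriangles S s 1) ∪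
    (initialTriangles S s (-1) ∪ sweepTriangles S s (-1))

/-- The union `C(S)` of the coverings `C_S(s)`. It is a family: a triangle that belongs to the
coverings of several segments occurs once for each of them, as a pair `(s, Δ)`. -/
def coverFamily (S : Finset Seg) : Set (Seg × Set Plane) :=
  {T | T.1 ∈ S ∧ T.2 ∈ cover S T.1}

/-- The members of `C(S)` that contain the point `p`. -/
def trianglesAt (S : Finset Seg) (p : Plane) : Set (Seg × Set Plane) :=
  {T ∈ coverFamily S | p ∈ T.2}

/-- The segments of `S` that are visible from `p`. -/
def segmentsAt (S : Finset Seg) (p : Plane) : Set Seg :=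
  {s | s ∈ S ∧ SegVisible S s p}

/-- The four sides of the quadrilateral `abcd`. -/
def sides (a b c d : Plane) : Set (Set Plane) :=
  {segment ℝ a b, segment ℝ b c, segment ℝ c d, segment ℝ d a}

/-- The quadrilateral `abcd` is a nondegenerate rectangle whose four sides belong to `S`; all
other elements of `S` lie in its interior, and they are pairwise disjoint. -/
structure IsFramed (S : Finset Seg) (a b c d : Plane) : Prop where
  parallelogram : a + c = b + d
  right_angle : (b.1 - a.1) * (d.1 - a.1) + (b.2 - a.2) * (d.2 - a.2) = 0
  ne_left : a ≠ b
  ne_right : a ≠ d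
  sides_mem : ∀ A ∈ sides a b c d, ∃ s ∈ S, s.carrier = A
  inside : ∀ s ∈ S, s.carrier ∉ sides a b c d →
    s.carrier ⊆ interior (convexHull ℝ {a, b, c, d})
  disjoint : ∀ s ∈ S, ∀ t ∈ S, s.carrier ∉ sides a b c d → t.carrier ∉ sides a b c d →
    s ≠ t → Disjoint s.carrier t.carrier

end SegVis

open Set Filter Topology

namespace SegVis

variable {S : Finset Seg} {R : Set Plane}

/-! ### Elementary plane geometry -/

/-! Fix `p` and call a maximal open parameter interval of `s` whose points are visible from `p` a
visible part of `s`. The theorem rests on the fact that triangles of the covering of `s` around `p`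
stand for visible parts of `s`, each triangle recording where its part begins on the left.

Upper bound. Since `p` avoids the triangle boundaries, it is interior to every triangle containing
it. Inside an initial triangle, `p` sees the left endpoint of `s`, and a visible part begins at
parameter 0. Inside a sweep triangle, `p` lies on the active edge at one moment `r` of the sweep;
the edge's starting point hides `s.pt r`, while points just to the right are visible, so a visible
part begins at `r` (`CorrespondsTo.exists_piece`). Conversely, `s`, the side and `r` determine the
triangle, because first hits along a ray are unique (`CorrespondsTo.unique`). Each visible part is
then charged to an endpoint `q`, visible from `p`, in the direction of its counterclockwise first
end (`exists_visible_end`). What `p` sees just counterclockwise of `q` recovers the part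
(`StartsAt.unique`), so triangles inject into visible endpoints. Each of these belongs to a visible
segment, and a segment has only two endpoints.

Lower bound. Suppose `s` is visible from a point on no line through two endpoints. At the left end
of a visible part, either the left endpoint of `s` is seen, or exactly one endpoint blocks the view
and its active edge runs through the point (`Frame.exists_witness`). This gives a line spanning a
triangle, but its parameter may be an end of a maximal interval or isolated. Moreover, `p` itself
need not be generic. Both problems vanish by letting generic points tend to `p` along a parabola
that meets each line in finitely many points: an ultrafilter fixes all finite choices, the
parameters converge without attaining their limit, and tameness puts them eventually into a single
maximal interval. The triangle over that interval is closed, so it contains `p`. -/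

lemma cross_add_right (u v w : Plane) : cross u (v + w) = cross u v + cross u w := by
  simp only [cross, Prod.fst_add, Prod.snd_add]; ring

lemma cross_sub_right (u v w : Plane) : cross u (v - w) = cross u v - cross u w := by
  simp only [cross, Prod.fst_sub, Prod.snd_sub]; ring

lemma cross_smul_right (u v : Plane) (k : ℝ) : cross u (k • v) = k * cross u v := by
  simp only [cross, Prod.smul_fst, Prod.smul_snd, smul_eq_mul]; ring

lemma cross_add_left (u v w : Plane) : cross (u + v) w = cross u w + cross v w := by
  simp only [cross, Prod.fst_add, Prod.snd_add]; ring

lemma cross_sub_left (u v w : Plane) : cross (u - v) w = cross u w - cross v w := by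
  simp only [cross, Prod.fst_sub, Prod.snd_sub]; ring

lemma cross_smul_left (u v : Plane) (k : ℝ) : cross (k • u) v = k * cross u v := by
  simp only [cross, Prod.smul_fst, Prod.smul_snd, smul_eq_mul]; ring

lemma cross_self (u : Plane) : cross u u = 0 := by
  simp only [cross]; ring

lemma cross_swap (u v : Plane) : cross u v = -cross v u := by
  simp only [cross]; ring

lemma cross_zero_right (u : Plane) : cross u 0 = 0 := by
  simp [cross]

@[fun_prop]
lemma continuous_cross {X : Type*} [TopologicalSpace X] {f g : X → Plane} (hf : Continuous f)
    (hg : Continuous g) : Continuous fun x => cross (f x) (g x) := by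
  unfold cross; fun_prop

lemma mem_openSegment_iff {p x z : Plane} :
    z ∈ openSegment ℝ p x ↔ ∃ l : ℝ, 0 < l ∧ l < 1 ∧ z = p + l • (x - p) := by
  rw [openSegment_eq_image']
  constructor
  · rintro ⟨l, ⟨h0, h1⟩, rfl⟩; exact ⟨l, h0, h1, rfl⟩
  · rintro ⟨l, h0, h1, rfl⟩; exact ⟨l, ⟨h0, h1⟩, rfl⟩

namespace Seg

/-- The direction vector of a segment, from left to right. -/
def dir (s : Seg) : Plane := s.right - s.left

lemma dir_fst_pos (s : Seg) : 0 < s.dir.1 := by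
  have := s.lt
  simp only [dir, Prod.fst_sub]; linarith

lemma pt_eq (s : Seg) (r : ℝ) : s.pt r = s.left + r • s.dir := rfl

lemma pt_zero (s : Seg) : s.pt 0 = s.left := by simp [pt]

lemma pt_one (s : Seg) : s.pt 1 = s.right := by simp [pt]

lemma mem_carrier {s : Seg} {z : Plane} : z ∈ s.carrier ↔ ∃ r : ℝ, 0 ≤ r ∧ r ≤ 1 ∧ z = s.pt r := by
  rw [carrier, segment_eq_image']
  constructor
  · rintro ⟨r, ⟨h0, h1⟩, rfl⟩; exact ⟨r, h0, h1, rfl⟩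
  · rintro ⟨r, h0, h1, rfl⟩; exact ⟨r, ⟨h0, h1⟩, rfl⟩

lemma pt_mem (s : Seg) {r : ℝ} (h0 : 0 ≤ r) (h1 : r ≤ 1) : s.pt r ∈ s.carrier :=
  mem_carrier.2 ⟨r, h0, h1, rfl⟩

lemma left_mem (s : Seg) : s.left ∈ s.carrier := left_mem_segment ℝ _ _

lemma right_mem (s : Seg) : s.right ∈ s.carrier := right_mem_segment ℝ _ _

lemma convex_carrier (s : Seg) : Convex ℝ s.carrier := convex_segment _ _

lemma isCompact_carrier (s : Seg) : IsCompact s.carrier := by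
  rw [carrier, segment_eq_image']
  exact isCompact_Icc.image (by fun_prop)

lemma isClosed_carrier (s : Seg) : IsClosed s.carrier := s.isCompact_carrier.isClosed

@[fun_prop]
lemma continuous_pt (s : Seg) : Continuous s.pt := by
  unfold pt; fun_prop

lemma pt_injective (s : Seg) : Function.Injective s.pt := by
  intro r r' h
  have h1 := congrArg Prod.fst h
  simp only [pt_eq, Prod.fst_add, Prod.smul_fst, smul_eq_mul, add_right_inj] at h1
  exact mul_right_cancel₀ s.dir_fst_pos.ne' h1

lemma cross_dir_pt (s : Seg) (r : ℝ) : cross s.dir (s.pt r - s.left) = 0 := by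
  simp [pt_eq, cross_smul_right, cross_self]

lemma cross_dir_of_mem {s : Seg} {z : Plane} (hz : z ∈ s.carrier) :
    cross s.dir (z - s.left) = 0 := by
  obtain ⟨r, -, -, rfl⟩ := mem_carrier.1 hz
  exact s.cross_dir_pt r

lemma HasEnds.mem_left {f : Seg} {q u : Plane} (h : f.HasEnds q u) : q ∈ f.carrier := by
  rcases h with ⟨rfl, -⟩ | ⟨rfl, -⟩
  exacts [f.left_mem, f.right_mem]

lemma HasEnds.carrier_eq {f : Seg} {q u : Plane} (h : f.HasEnds q u) :
    f.carrier = segment ℝ q u := by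
  rcases h with ⟨rfl, rfl⟩ | ⟨rfl, rfl⟩
  exacts [rfl, segment_symm ℝ _ _]

end Seg

lemma Visible.symm {S : Finset Seg} {p q : Plane} (h : Visible S p q) : Visible S q p := by
  rcases h with rfl | h
  · exact Or.inl rfl
  · exact Or.inr fun s hs => by rw [openSegment_symm]; exact h s hs

lemma visible_comm {S : Finset Seg} {p q : Plane} : Visible S p q ↔ Visible S q p :=
  ⟨Visible.symm, Visible.symm⟩

lemma Visible.notMem {S : Finset Seg} {p q z : Plane} (h : Visible S p q) (hpq : p ≠ q)
    (hz : z ∈ openSegment ℝ p q) {f : Seg} (hf : f ∈ S) : z ∉ f.carrier := fun hzf =>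
  Set.disjoint_left.1 ((h.resolve_left hpq) f hf) hz hzf

/-- A convex set is seen in perspective as an interval. -/
lemma ordConnected_perspective {K : Set Plane} (hK : Convex ℝ K) {I : Set ℝ} (hI : I.OrdConnected)
    (hpos : ∀ l ∈ I, ∀ m ∈ I, 0 < l * m) (o x d : Plane) :
    {r : ℝ | ∃ l ∈ I, o + l • (x + r • d - o) ∈ K}.OrdConnected := by
  refine ⟨?_⟩
  rintro r₁ ⟨l, hl, h₁⟩ r₂ ⟨m, hm, h₂⟩ r ⟨h1, h2⟩
  rcases eq_or_lt_of_le h1 with rfl | h1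
  · exact ⟨l, hl, h₁⟩
  have hlm := hpos l hl m hm
  have hll := hpos l hl l hl
  have hl0 : l ≠ 0 := by rintro rfl; simp at hll
  -- The chord between the two given points of `K` crosses the line from `o` towards parameter `r`
  -- at the weight `σ` solving `(1 - σ) * l * (r - r₁) = σ * m * (r₂ - r)`. The common sign of `l`
  -- and `m` puts `σ` in `[0, 1]`.
  set D := l * (r - r₁) + m * (r₂ - r) with hD
  have hlD : 0 < l * D := by
    have : l * D = (l * l) * (r - r₁) + (l * m) * (r₂ - r) := by rw [hD]; ring
    rw [this]
    have := mul_pos hll (sub_pos.2 h1)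
    have := mul_nonneg hlm.le (sub_nonneg.2 h2)
    linarith
  have hD0 : D ≠ 0 := by rintro h; rw [h] at hlD; simp at hlD
  set σ := l * (r - r₁) / D with hσ
  have hσ0 : 0 ≤ σ := by
    have : σ = (l * l * (r - r₁)) / (l * D) := by rw [hσ]; field_simp
    rw [this]
    exact div_nonneg (mul_nonneg hll.le (sub_pos.2 h1).le) hlD.le
  have hσ1 : 1 - σ = m * (r₂ - r) / D := by
    rw [hσ, eq_div_iff hD0, sub_mul, div_mul_cancel₀ _ hD0, hD]; ring
  have hσ1' : 0 ≤ 1 - σ := by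
    have : 1 - σ = (l * m * (r₂ - r)) / (l * D) := by rw [hσ1]; field_simp
    rw [this]
    exact div_nonneg (mul_nonneg hlm.le (sub_nonneg.2 h2)) hlD.le
  have hkey : (1 - σ) * l * (r - r₁) = σ * m * (r₂ - r) := by
    rw [hσ1, hσ]; field_simp
  refine ⟨(1 - σ) * l + σ * m, ?_, ?_⟩
  · exact hI.convex hl hm hσ1' hσ0 (by ring)
  · have := hK h₁ h₂ hσ1' hσ0 (by ring)
    convert this using 1
    ext
    · simp only [Prod.fst_add, Prod.smul_fst, Prod.fst_sub, smul_eq_mul]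
      linear_combination d.1 * hkey
    · simp only [Prod.snd_add, Prod.smul_snd, Prod.snd_sub, smul_eq_mul]
      linear_combination d.2 * hkey

/-! ### Sets of reals that are decided on either side of every point -/

/-- Near every point, and on either side of it, membership in `A` is constant. -/
def Tame (A : Set ℝ) : Prop :=
  ∀ x, ((∀ᶠ r in 𝓝[>] x, r ∈ A) ∨ ∀ᶠ r in 𝓝[>] x, r ∉ A) ∧
    ((∀ᶠ r in 𝓝[<] x, r ∈ A) ∨ ∀ᶠ r in 𝓝[<] x, r ∉ A)

lemma Tame.compl {A : Set ℝ} (h : Tame A) : Tame Aᶜ := fun x =>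
  ⟨(h x).1.symm.imp_right fun h => h.mono fun _ hr => not_not.2 hr,
    (h x).2.symm.imp_right fun h => h.mono fun _ hr => not_not.2 hr⟩

lemma Tame.inter {A B : Set ℝ} (hA : Tame A) (hB : Tame B) : Tame (A ∩ B) := by
  intro x
  constructor
  · rcases (hA x).1 with h | h
    · rcases (hB x).1 with h' | h'
      · exact Or.inl (h.and h')
      · exact Or.inr (h'.mono fun _ hr hr' => hr hr'.2)
    · exact Or.inr (h.mono fun _ hr hr' => hr hr'.1)
  · rcases (hA x).2 with h | h
    · rcases (hB x).2 with h' | h'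
      · exact Or.inl (h.and h')
      · exact Or.inr (h'.mono fun _ hr hr' => hr hr'.2)
    · exact Or.inr (h.mono fun _ hr hr' => hr hr'.1)

lemma Tame.union {A B : Set ℝ} (hA : Tame A) (hB : Tame B) : Tame (A ∪ B) := by
  have := (hA.compl.inter hB.compl).compl
  rwa [← compl_union, compl_compl] at this

lemma tame_forall {ι : Type*} (S : Finset ι) {P : ι → ℝ → Prop} (h : ∀ i ∈ S, Tame {r | P i r}) :
    Tame {r | ∀ i ∈ S, P i r} := by
  classical
  induction S using Finset.induction_on with
  | empty => intro x; simp
  | insert i S hi ih =>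
    have h1 := (h i (Finset.mem_insert_self _ _)).inter
      (ih fun j hj => h j (Finset.mem_insert_of_mem hj))
    convert h1 using 1
    ext r
    simp

/-- If `A` has points arbitrarily close to `x` on one side, it contains everything between any two
of them, hence a one-sided punctured neighbourhood. -/
lemma _root_.Set.OrdConnected.tame {A : Set ℝ} (hA : A.OrdConnected) : Tame A := by
  intro x
  constructor
  · by_cases h : ∃ᶠ r in 𝓝[>] x, r ∈ A
    · obtain ⟨r₀, h₀, h₀x⟩ := (h.and_eventually self_mem_nhdsWithin).exists
      refine Or.inl ?_
      filter_upwards [Ioo_mem_nhdsGT h₀x] with r hr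
      obtain ⟨r₁, h₁, h₁x⟩ := (h.and_eventually (Ioo_mem_nhdsGT hr.1)).exists
      exact hA.out h₁ h₀ ⟨h₁x.2.le, hr.2.le⟩
    · exact Or.inr (not_frequently.1 h)
  · by_cases h : ∃ᶠ r in 𝓝[<] x, r ∈ A
    · obtain ⟨r₀, h₀, h₀x⟩ := (h.and_eventually self_mem_nhdsWithin).exists
      refine Or.inl ?_
      filter_upwards [Ioo_mem_nhdsLT h₀x] with r hr
      obtain ⟨r₁, h₁, h₁x⟩ := (h.and_eventually (Ioo_mem_nhdsLT hr.2)).exists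
      exact hA.out h₀ h₁ ⟨hr.1.le, h₁x.1.le⟩
    · exact Or.inr (not_frequently.1 h)

lemma _root_.Set.Subsingleton.tame {A : Set ℝ} (hA : A.Subsingleton) : Tame A :=
  Set.OrdConnected.tame ⟨fun x hx y hy z hz => by
    obtain rfl := hA hx hy
    rwa [le_antisymm hz.2 hz.1]⟩

lemma tame_affine_pos (a b : ℝ) : Tame {r | 0 < a + r * b} := by
  refine Set.OrdConnected.tame ⟨?_⟩
  rintro r₁ h₁ r₂ h₂ r ⟨h1, h2⟩
  simp only [mem_ofPred_eq] at *
  rcases le_total 0 b with hb | hb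
  · nlinarith
  · nlinarith

/-! ### Tameness of visibility and of active edges along a segment -/

/-- By perspective from `o`, each `f` hides an interval of parameters of `s`; visibility is the
finite intersection of the complements, up to the parameter where `o` lies on `s`. -/
lemma tame_visible (S : Finset Seg) (o : Plane) (s : Seg) : Tame {r | Visible S o (s.pt r)} := by
  have h1 : Tame {r | o = s.pt r} :=
    Set.Subsingleton.tame fun r hr r' hr' => s.pt_injective (hr.symm.trans hr')
  refine h1.union (tame_forall S fun f _ => ?_)
  have h2 := (ordConnected_perspective f.convex_carrier (I := Ioo 0 1) ordConnected_Ioo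
    (fun l hl m hm => mul_pos hl.1 hm.1) o s.left s.dir).tame.compl
  convert h2 using 1
  ext r
  simp only [mem_ofPred_eq, mem_compl_iff, not_exists, not_and, Set.disjoint_left,
    mem_openSegment_iff]
  constructor
  · intro h l hl
    exact h ⟨l, hl.1, hl.2, rfl⟩
  · rintro h z ⟨l, h0, h1, rfl⟩
    exact h l ⟨h0, h1⟩

lemma cross_off_pt (s : Seg) (q d : Plane) (r : ℝ) :
    cross d (q - s.pt r) = cross d (q - s.left) - r * cross d s.dir := by
  rw [Seg.pt_eq, ← sub_sub, cross_sub_right, cross_smul_right]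

/-- A point from which two different points of a segment are projected to points of another
segment is not on the line of the latter. -/
lemma off_line_of_two_hits {s t : Seg} {q : Plane} (hq : cross s.dir (q - s.left) ≠ 0)
    {r₁ r₂ c₁ c₂ : ℝ} (hr : r₁ ≠ r₂) (h₁ : 0 < c₁) (h₂ : 0 < c₂)
    (hw₁ : q + c₁ • (q - s.pt r₁) ∈ t.carrier) (hw₂ : q + c₂ • (q - s.pt r₂) ∈ t.carrier) :
    cross t.dir (q - t.left) ≠ 0 := by
  intro h
  have e₁ := Seg.cross_dir_of_mem hw₁
  have e₂ := Seg.cross_dir_of_mem hw₂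
  rw [add_sub_right_comm, cross_add_right, h, zero_add, cross_smul_right] at e₁ e₂
  replace e₁ := (mul_eq_zero.1 e₁).resolve_left h₁.ne'
  replace e₂ := (mul_eq_zero.1 e₂).resolve_left h₂.ne'
  rw [cross_off_pt] at e₁ e₂
  have e₃ : cross t.dir s.dir = 0 := by
    have : (r₁ - r₂) * cross t.dir s.dir = 0 := by linear_combination e₂ - e₁
    exact (mul_eq_zero.1 this).resolve_left (sub_ne_zero.2 hr)
  rw [e₃, mul_zero, sub_zero] at e₁
  apply hq
  have ht := t.dir_fst_pos
  have : t.dir.1 * cross s.dir (q - s.left) = 0 := by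
    simp only [cross] at *
    linear_combination s.dir.1 * e₁ - (q - s.left).1 * e₃
  exact (mul_eq_zero.1 this).resolve_left ht.ne'

/-- A ray from a point off the line of a segment meets that segment at most once. -/
lemma hit_unique {t : Seg} {q v : Plane} (hq : cross t.dir (q - t.left) ≠ 0) {c c' : ℝ}
    (h : q + c • v ∈ t.carrier) (h' : q + c' • v ∈ t.carrier) : c = c' := by
  have e := Seg.cross_dir_of_mem h
  have e' := Seg.cross_dir_of_mem h'
  rw [add_sub_right_comm, cross_add_right, cross_smul_right] at e e'
  have hv : cross t.dir v ≠ 0 := by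
    intro h0; rw [h0, mul_zero, add_zero] at e; exact hq e
  exact mul_right_cancel₀ hv (by linear_combination e - e')

/-- If `q` is on the line of `t`, at most one parameter qualifies. Otherwise a ray from `q` meets
`t` only once, so the condition says that the ray hits `t` but, for every `f`, misses the part of
`f` in the union of the open segments from `q` to `t`. All these sets are convex, so perspective
through `q` (negative factors) applies to each. -/
lemma tame_far_end (S : Finset Seg) {s t : Seg} {q : Plane} (hq : cross s.dir (q - s.left) ≠ 0) :
    Tame {r | ∃ c : ℝ, 0 < c ∧ q + c • (q - s.pt r) ∈ t.carrier ∧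
      Visible S q (q + c • (q - s.pt r))} := by
  have hqs : ∀ r, q ≠ s.pt r := by
    rintro r rfl; exact hq (s.cross_dir_pt r)
  by_cases ht : cross t.dir (q - t.left) = 0
  · refine Set.Subsingleton.tame ?_
    rintro r₁ ⟨c₁, h₁, hw₁, -⟩ r₂ ⟨c₂, h₂, hw₂, -⟩
    by_contra hr
    exact off_line_of_two_hits hq hr h₁ h₂ hw₁ hw₂ ht
  have key : ∀ K : Set Plane, Convex ℝ K → Tame {r | ∃ c : ℝ, 0 < c ∧ q + c • (q - s.pt r) ∈ K} := by
    intro K hK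
    have := (ordConnected_perspective hK (I := Iio 0) ordConnected_Iio
      (fun l hl m hm => mul_pos_of_neg_of_neg hl hm) q s.left s.dir).tame
    convert this using 1
    ext r
    constructor
    · rintro ⟨c, hc, h⟩
      refine ⟨-c, by simpa using hc, ?_⟩
      convert h using 1
      rw [Seg.pt_eq]; module
    · rintro ⟨c, hc, h⟩
      refine ⟨-c, by simpa using hc, ?_⟩
      convert h using 1
      rw [Seg.pt_eq]; module
  have hJ : Convex ℝ {z : Plane | ∃ w ∈ t.carrier, ∃ l : ℝ, 0 < l ∧ l < 1 ∧ z = q + l • (w - q)} := by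
    rintro _ ⟨w₁, hw₁, l₁, h0, h1, rfl⟩ _ ⟨w₂, hw₂, l₂, h0', h1', rfl⟩ a b ha hb hab
    have hpos : 0 < a * l₁ + b * l₂ := by
      rcases eq_or_lt_of_le ha with rfl | ha
      · have : b = 1 := by linarith
        subst this; linarith
      · nlinarith [mul_pos ha h0, mul_nonneg hb h0'.le]
    refine ⟨(a * l₁ / (a * l₁ + b * l₂)) • w₁ + (b * l₂ / (a * l₁ + b * l₂)) • w₂,
      t.convex_carrier hw₁ hw₂ (by positivity) (by positivity) (by field_simp),
      a * l₁ + b * l₂, hpos, ?_, ?_⟩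
    · rcases eq_or_lt_of_le ha with rfl | ha
      · have : b = 1 := by linarith
        subst this; linarith
      · nlinarith
    · obtain rfl : b = 1 - a := by linarith
      ext <;> simp only [Prod.fst_add, Prod.smul_fst, Prod.fst_sub, Prod.snd_add, Prod.smul_snd,
        Prod.snd_sub, smul_eq_mul] <;> field_simp <;> ring
  have h1 := (key t.carrier t.convex_carrier).inter (tame_forall S fun f _ =>
    (key _ (f.convex_carrier.inter hJ)).compl)
  convert h1 using 1
  ext r
  simp only [mem_ofPred_eq, mem_inter_iff]
  constructor
  · rintro ⟨c, hc, hw, hv⟩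
    refine ⟨⟨c, hc, hw⟩, ?_⟩
    rintro f hf ⟨c', hc', hz, w, hwt, l, hl0, hl1, hzw⟩
    have hzw' : q + (c' / l) • (q - s.pt r) = w := by
      have : c' • (q - s.pt r) = l • (w - q) := by simpa using hzw
      rw [div_eq_inv_mul, mul_smul, this, smul_smul, inv_mul_cancel₀ hl0.ne']; module
    have hcc : c' / l = c := hit_unique ht (hzw' ▸ hwt) hw
    have hqw : q ≠ q + c • (q - s.pt r) := by
      intro h
      have : c • (q - s.pt r) = 0 := by simpa using h
      rcases smul_eq_zero.1 this with h | h
      · exact hc.ne' h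
      · exact hqs r (sub_eq_zero.1 h)
    refine hv.notMem hqw ?_ hf hz
    rw [mem_openSegment_iff]
    refine ⟨l, hl0, hl1, ?_⟩
    rw [← hcc, add_sub_cancel_left, smul_smul, mul_div_cancel₀ _ hl0.ne']
  · rintro ⟨⟨c, hc, hw⟩, h⟩
    refine ⟨c, hc, hw, Or.inr fun f hf => Set.disjoint_left.2 ?_⟩
    intro z hz hzf
    obtain ⟨l, hl0, hl1, rfl⟩ := mem_openSegment_iff.1 hz
    refine h f hf ⟨l * c, by positivity, ⟨?_, _, hw, l, hl0, hl1, ?_⟩⟩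
    · convert hzf using 1
      module
    · module

/-- The predicate whose maximal intervals are the far sides of the initial triangles. -/
def InitialEdge (S : Finset Seg) (s : Seg) (ε : ℝ) (t : Seg) (r : ℝ) : Prop :=
  s.OnSide ε (t.pt r) ∧ Visible S s.left (t.pt r)

lemma onSide_iff {s : Seg} {ε : ℝ} {q : Plane} :
    s.OnSide ε q ↔ 0 < ε * cross s.dir (q - s.left) := Iff.rfl

lemma Seg.OnSide.cross_ne {s : Seg} {ε : ℝ} {q : Plane} (h : s.OnSide ε q) :
    cross s.dir (q - s.left) ≠ 0 := by
  intro h0; rw [onSide_iff, h0, mul_zero] at h; exact lt_irrefl _ h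

lemma tame_initialEdge (S : Finset Seg) (s : Seg) (ε : ℝ) (t : Seg) :
    Tame {r | InitialEdge S s ε t r} := by
  refine Tame.inter (A := {r | s.OnSide ε (t.pt r)}) ?_ (tame_visible S s.left t)
  convert tame_affine_pos (ε * cross s.dir (t.left - s.left)) (ε * cross s.dir t.dir) using 1
  ext r
  simp only [mem_ofPred_eq, onSide_iff]
  rw [Seg.pt_eq, add_sub_right_comm, cross_add_right, cross_smul_right]
  ring_nf

lemma tame_activeEdge (S : Finset Seg) (s : Seg) (ε : ℝ) (q u : Plane) (t : Seg) :
    Tame {r | ActiveEdge S s ε q u t (s.pt r)} := by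
  by_cases hq : s.OnSide ε q
  · have h1 : Tame {r | Visible S (s.pt r) q} := by
      simp only [visible_comm (q := q)]
      exact tame_visible S q s
    have h2 := tame_affine_pos (ε * cross (q - s.left) (u - q)) (-(ε * cross s.dir (u - q)))
    have h3 := h1.inter (h2.inter (tame_far_end S (t := t) hq.cross_ne))
    convert h3 using 1
    ext r
    simp only [ActiveEdge, mem_ofPred_eq, mem_inter_iff, hq, true_and]
    rw [Seg.pt_eq, ← sub_sub, cross_sub_left, cross_smul_left]
    ring_nf
  · refine Set.Subsingleton.tame fun r hr => ?_
    exact absurd hr.1 hq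

/-! ### Maximal intervals -/

/-- The two ends can be pushed outwards independently, each with the other end held fixed. -/
lemma IsMaxInterval.exists_of_forall {P : ℝ → Prop} {c d : ℝ} (hc : 0 ≤ c) (hcd : c < d)
    (hd : d ≤ 1) (h : ∀ r ∈ Ioo c d, P r) : ∃ a b, IsMaxInterval P a b ∧ a ≤ c ∧ d ≤ b := by
  let A := {a | 0 ≤ a ∧ a ≤ c ∧ ∀ r ∈ Ioo a d, P r}
  let B := {b | b ≤ 1 ∧ d ≤ b ∧ ∀ r ∈ Ioo c b, P r}
  have hAb : BddBelow A := ⟨0, fun a ha => ha.1⟩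
  have hBb : BddAbove B := ⟨1, fun b hb => hb.1⟩
  have hcA : c ∈ A := ⟨hc, le_rfl, h⟩
  have hdB : d ∈ B := ⟨hd, le_rfl, h⟩
  have ha : sInf A ≤ c := csInf_le hAb hcA
  have hb : d ≤ sSup B := le_csSup hBb hdB
  refine ⟨sInf A, sSup B, ⟨le_csInf ⟨c, hcA⟩ fun a ha => ha.1, by linarith,
    csSup_le ⟨d, hdB⟩ fun b hb => hb.1, ?_, ?_⟩, ha, hb⟩
  · rintro r ⟨h1, h2⟩
    obtain ⟨a, haA, har⟩ := exists_lt_of_csInf_lt ⟨c, hcA⟩ h1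
    obtain ⟨b, hbB, hrb⟩ := exists_lt_of_lt_csSup ⟨d, hdB⟩ h2
    rcases le_or_gt d r with hr | hr
    · exact hbB.2.2 r ⟨by linarith, hrb⟩
    · exact haA.2.2 r ⟨har, hr⟩
  · intro a' b' h0 h1 h2 h3 h4
    have ha' : a' ∈ A := ⟨h0, h1.trans ha, fun r hr => h4 r ⟨hr.1, hr.2.trans_le (hb.trans h2)⟩⟩
    have hb' : b' ∈ B := ⟨h3, hb.trans h2, fun r hr => h4 r ⟨(h1.trans ha).trans_lt hr.1, hr.2⟩⟩
    exact ⟨le_antisymm h1 (csInf_le hAb ha'), le_antisymm (le_csSup hBb hb') h2⟩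

/-- The union of two overlapping intervals is again an interval on which `P` holds, so maximality
makes both equal to it. -/
lemma IsMaxInterval.eq_of_mem {P : ℝ → Prop} {a b a' b' r : ℝ} (h : IsMaxInterval P a b)
    (h' : IsMaxInterval P a' b') (hr : r ∈ Ioo a b) (hr' : r ∈ Ioo a' b') : a = a' ∧ b = b' := by
  have hP : ∀ x ∈ Ioo (min a a') (max b b'), P x := by
    rintro x ⟨h1, h2⟩
    rcases lt_trichotomy x r with hx | rfl | hx
    · rcases min_lt_iff.1 h1 with h1 | h1
      · exact h.2.2.2.1 x ⟨h1, hx.trans hr.2⟩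
      · exact h'.2.2.2.1 x ⟨h1, hx.trans hr'.2⟩
    · exact h.2.2.2.1 x hr
    · rcases lt_max_iff.1 h2 with h2 | h2
      · exact h.2.2.2.1 x ⟨hr.1.trans hx, h2⟩
      · exact h'.2.2.2.1 x ⟨hr'.1.trans hx, h2⟩
  have h0 : 0 ≤ min a a' := le_min h.1 h'.1
  have h1 : max b b' ≤ 1 := max_le h.2.2.1 h'.2.2.1
  have e := h.2.2.2.2 _ _ h0 (min_le_left _ _) (le_max_left _ _) h1 hP
  have e' := h'.2.2.2.2 _ _ h0 (min_le_right _ _) (le_max_right _ _) h1 hP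
  exact ⟨e.1.symm.trans e'.1, e.2.symm.trans e'.2⟩

/-- Along an ultrafilter, values of a tame predicate that converge to a different point
eventually lie in one maximal interval. -/
lemma Tame.exists_isMaxInterval {P : ℝ → Prop} (hP : Tame {r | P r}) {X : Type*} {U : Ultrafilter X}
    {r : X → ℝ} {r₀ : ℝ} (hr : Tendsto r U (𝓝 r₀)) (hne : ∀ᶠ x in U, r x ≠ r₀)
    (hPr : ∀ᶠ x in U, P (r x)) (h01 : ∀ᶠ x in U, 0 ≤ r x ∧ r x ≤ 1) :
    ∃ a b, IsMaxInterval P a b ∧ ∀ᶠ x in U, r x ∈ Ioo a b := by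
  have h0 : 0 ≤ r₀ := ge_of_tendsto hr (h01.mono fun _ h => h.1)
  have h1 : r₀ ≤ 1 := le_of_tendsto hr (h01.mono fun _ h => h.2)
  -- The ultrafilter decides from which side the limit is approached.
  have hlt : (∀ᶠ x in U, r₀ < r x) ∨ ∀ᶠ x in U, r x < r₀ := by
    rw [← Ultrafilter.eventually_or]
    exact hne.mono fun x hx => hx.symm.lt_or_gt
  rcases hlt with hlt | hlt
  · have ht : Tendsto r U (𝓝[>] r₀) := tendsto_nhdsWithin_iff.2 ⟨hr, hlt⟩
    rcases (hP r₀).1 with h | h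
    · obtain ⟨d, hd, hd'⟩ := (mem_nhdsGT_iff_exists_Ioo_subset' (lt_add_one r₀)).1 h
      have hr1 : r₀ < 1 := by
        obtain ⟨x, hx, hx'⟩ := (hlt.and h01).exists
        linarith
      obtain ⟨a, b, hab, ha, hb⟩ := IsMaxInterval.exists_of_forall h0
        (lt_min hd hr1) (min_le_right d 1) (fun x hx => hd' ⟨hx.1, hx.2.trans_le (min_le_left _ _)⟩)
      refine ⟨a, b, hab, ?_⟩
      filter_upwards [ht (Ioo_mem_nhdsGT (lt_min hd hr1))] with x hx
      exact ⟨ha.trans_lt hx.1, hx.2.trans_le hb⟩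
    · obtain ⟨x, hx, hx'⟩ := ((ht.eventually h).and hPr).exists
      exact absurd hx' hx
  · have ht : Tendsto r U (𝓝[<] r₀) := tendsto_nhdsWithin_iff.2 ⟨hr, hlt⟩
    rcases (hP r₀).2 with h | h
    · obtain ⟨d, hd, hd'⟩ := (mem_nhdsLT_iff_exists_Ioo_subset' (sub_one_lt r₀)).1 h
      have hr0 : 0 < r₀ := by
        obtain ⟨x, hx, hx'⟩ := (hlt.and h01).exists
        linarith
      obtain ⟨a, b, hab, ha, hb⟩ := IsMaxInterval.exists_of_forall (le_max_right d 0)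
        (max_lt hd hr0) h1 (fun x hx => hd' ⟨(le_max_left _ _).trans_lt hx.1, hx.2⟩)
      refine ⟨a, b, hab, ?_⟩
      filter_upwards [ht (Ioo_mem_nhdsLT (max_lt hd hr0))] with x hx
      exact ⟨ha.trans_lt hx.1, hx.2.trans_le hb⟩
    · obtain ⟨x, hx, hx'⟩ := ((ht.eventually h).and hPr).exists
      exact absurd hx' hx

/-! ### Segments framed by a convex region -/

/-- The properties of a framed set of segments that matter for visibility from inner points. -/
structure Frame (S : Finset Seg) (R : Set Plane) : Prop where
  convex : Convex ℝ R
  subset : ∀ s ∈ S, s.carrier ⊆ R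
  hit : ∀ z ∈ interior R, ∀ v : Plane, v ≠ 0 → ∃ c : ℝ, 0 < c ∧ ∃ s ∈ S, z + c • v ∈ s.carrier
  -- This allows for the corners of the rectangle, the only points shared by different elements.
  meet : ∀ s ∈ S, ∀ t ∈ S, s ≠ t → ∀ z ∈ s.carrier, z ∈ t.carrier →
    z ∉ interior R ∧ (z = s.left ∨ z = s.right)
  inside_or_disjoint : ∀ s ∈ S, s.carrier ⊆ interior R ∨ Disjoint s.carrier (interior R)

lemma Frame.openSegment_subset (F : Frame S R) {p x : Plane} (hp : p ∈ interior R) (hx : x ∈ R) :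
    openSegment ℝ p x ⊆ interior R :=
  F.convex.openSegment_interior_self_subset_interior hp hx

/-- Compactness of the parameter interval: the condition is open at each point of the closed
segment. This is why closed sight lines have to be checked at both endpoints. -/
lemma eventually_disjoint_segment {K : Set Plane} (hK : IsClosed K) {p x₀ : Plane}
    (h : Disjoint (segment ℝ p x₀) K) : ∀ᶠ x in 𝓝 x₀, Disjoint (segment ℝ p x) K := by
  have hI : IsCompact (Icc (0 : ℝ) 1) := isCompact_Icc
  have := hI.eventually_forall_of_forall_eventually (x₀ := x₀)
    (P := fun x l => p + l • (x - p) ∈ Kᶜ) (by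
      intro l hl
      have hc : Continuous fun z : Plane × ℝ => p + z.2 • (z.1 - p) := by fun_prop
      refine hc.continuousAt.eventually (hK.isOpen_compl.mem_nhds ?_)
      rw [segment_eq_image'] at h
      exact Set.disjoint_left.1 h ⟨l, hl, rfl⟩)
  filter_upwards [this] with x hx
  rw [segment_eq_image', Set.disjoint_left]
  rintro _ ⟨l, hl, rfl⟩
  exact hx l hl

lemma disjoint_openSegment_self {s : Seg} {p : Plane} (hps : cross s.dir (p - s.left) ≠ 0) (r : ℝ) :
    Disjoint (openSegment ℝ p (s.pt r)) s.carrier := by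
  refine Set.disjoint_left.2 fun z hz hzf => ?_
  obtain ⟨l, hl0, hl1, rfl⟩ := mem_openSegment_iff.1 hz
  have e := Seg.cross_dir_of_mem hzf
  have h3 : p + l • (s.pt r - p) - s.left = (1 - l) • (p - s.left) + l • (s.pt r - s.left) := by
    module
  rw [h3, cross_add_right, cross_smul_right, cross_smul_right, s.cross_dir_pt r, mul_zero,
    add_zero] at e
  rcases mul_eq_zero.1 e with h | h
  · linarith
  · exact hps h

/-- If `p` is off the line of `s`, then the part of `s` that is visible from `p` is relatively
open. -/
lemma Frame.eventually_visible (F : Frame S R) {p : Plane} (hp : p ∈ interior R)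
    (hpS : ∀ f ∈ S, p ∉ f.carrier) {s : Seg} (hs : s ∈ S) (hps : cross s.dir (p - s.left) ≠ 0)
    {r₀ : ℝ} (h0 : 0 ≤ r₀) (h1 : r₀ ≤ 1) (hv : Visible S p (s.pt r₀)) :
    ∀ᶠ r in 𝓝 r₀, 0 ≤ r → r ≤ 1 → Visible S p (s.pt r) := by
  have hne : p ≠ s.pt r₀ := fun h => hpS s hs (h ▸ s.pt_mem h0 h1)
  have key : ∀ f ∈ S, ∀ᶠ r in 𝓝 r₀, 0 ≤ r → r ≤ 1 →
      Disjoint (openSegment ℝ p (s.pt r)) f.carrier := by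
    intro f hf
    by_cases hfs : f = s
    · subst hfs
      exact Eventually.of_forall fun r _ _ => disjoint_openSegment_self hps r
    -- An inner `f` misses the whole closed sight line, so it misses nearby ones too. A side of the
    -- frame never meets the open sight line of an inner point.
    · rcases F.inside_or_disjoint f hf with hin | hdis
      · have hd : Disjoint (segment ℝ p (s.pt r₀)) f.carrier := by
          rw [Set.disjoint_left]
          intro z hz hzf
          rw [← insert_endpoints_openSegment] at hz
          rcases hz with rfl | rfl | hz
          · exact hpS f hf hzf
          · exact (F.meet f hf s hs hfs _ hzf (s.pt_mem h0 h1)).1 (hin hzf)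
          · exact hv.notMem hne hz hf hzf
        have := s.continuous_pt.continuousAt.eventually
          (eventually_disjoint_segment f.isClosed_carrier hd)
        exact this.mono fun r hr _ _ => hr.mono_left (openSegment_subset_segment _ _ _)
      · refine Eventually.of_forall fun r h0 h1 => ?_
        exact (hdis.mono_right (F.openSegment_subset hp (F.subset s hs (s.pt_mem h0 h1)))).symm
  filter_upwards [(eventually_all_finset S).2 key] with r hr h0 h1
  exact Or.inr fun f hf => hr f hf h0 h1

/-- The interval structure of the visible part of a segment. -/
lemma Frame.exists_piece (F : Frame S R) {p : Plane} (hp : p ∈ interior R)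
    (hpS : ∀ f ∈ S, p ∉ f.carrier) {s : Seg} (hs : s ∈ S) (hps : cross s.dir (p - s.left) ≠ 0)
    (hv : SegVisible S s p) : ∃ a b, IsMaxInterval (fun r => Visible S p (s.pt r)) a b := by
  obtain ⟨y, hy, hv⟩ := hv
  obtain ⟨r, h0, h1, rfl⟩ := Seg.mem_carrier.1 hy
  obtain ⟨c, d, ⟨hc, hd⟩, hcd⟩ := mem_nhds_iff_exists_Ioo_subset.1
    (F.eventually_visible hp hpS hs hps h0 h1 hv)
  obtain ⟨a, b, hab, -, -⟩ := IsMaxInterval.exists_of_forall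
    (P := fun r => Visible S p (s.pt r)) (c := max c 0) (d := min d 1)
    (le_max_right _ _) (max_lt (lt_min (hc.trans hd) (by linarith))
      (lt_min (by linarith) one_pos)) (min_le_right _ _) (by
      rintro x ⟨hx1, hx2⟩
      rw [max_lt_iff] at hx1
      rw [lt_min_iff] at hx2
      exact hcd ⟨hx1.1, hx2.1⟩ hx1.2.le hx2.2.le)
  exact ⟨a, b, hab⟩

/-- Visibility is relatively open on `s`, so a maximal interval with a visible left end could be
enlarged there unless that end is the left endpoint of `s`. -/
lemma Frame.piece_left (F : Frame S R) {p : Plane} (hp : p ∈ interior R)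
    (hpS : ∀ f ∈ S, p ∉ f.carrier) {s : Seg} (hs : s ∈ S) (hps : cross s.dir (p - s.left) ≠ 0)
    {a b : ℝ} (hab : IsMaxInterval (fun r => Visible S p (s.pt r)) a b)
    (ha : Visible S p (s.pt a)) : a = 0 := by
  obtain ⟨h0, hlt, h1, hP, hmax⟩ := hab
  by_contra hne
  have h0' : 0 < a := lt_of_le_of_ne h0 (Ne.symm hne)
  obtain ⟨c, d, ⟨hc, hd⟩, hcd⟩ := mem_nhds_iff_exists_Ioo_subset.1
    (F.eventually_visible hp hpS hs hps h0 (by linarith) ha)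
  have := (hmax (max c 0) b (le_max_right _ _) (max_le hc.le h0) le_rfl h1 (by
    rintro r ⟨hr1, hr2⟩
    rw [max_lt_iff] at hr1
    rcases lt_or_ge a r with h | h
    · exact hP r ⟨h, hr2⟩
    · exact hcd ⟨hr1.1, by linarith⟩ hr1.2.le (by linarith))).1
  exact (max_lt hc h0').ne this

lemma Frame.piece_right (F : Frame S R) {p : Plane} (hp : p ∈ interior R)
    (hpS : ∀ f ∈ S, p ∉ f.carrier) {s : Seg} (hs : s ∈ S) (hps : cross s.dir (p - s.left) ≠ 0)
    {a b : ℝ} (hab : IsMaxInterval (fun r => Visible S p (s.pt r)) a b)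
    (hb : Visible S p (s.pt b)) : b = 1 := by
  obtain ⟨h0, hlt, h1, hP, hmax⟩ := hab
  by_contra hne
  have h1' : b < 1 := lt_of_le_of_ne h1 hne
  obtain ⟨c, d, ⟨hc, hd⟩, hcd⟩ := mem_nhds_iff_exists_Ioo_subset.1
    (F.eventually_visible hp hpS hs hps (by linarith) h1 hb)
  have := (hmax a (min d 1) h0 le_rfl (le_min hd.le h1) (min_le_right _ _) (by
    rintro r ⟨hr1, hr2⟩
    rw [lt_min_iff] at hr2
    rcases lt_or_ge r b with h | h
    · exact hP r ⟨hr1, h⟩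
    · exact hcd ⟨by linarith, hr2.1⟩ (by linarith) hr2.2.le)).2
  exact (lt_min hd h1').ne' this

/-- The first point of an element of `S` on a ray. -/
lemma exists_first_hit (S : Finset Seg) {o v : Plane} {c₁ c₂ : ℝ} (h0 : 0 ≤ c₁)
    (hfree : ∀ c, 0 < c → c < c₁ → ∀ f ∈ S, o + c • v ∉ f.carrier)
    (h1 : ∀ f ∈ S, o + c₁ • v ∉ f.carrier) (h12 : c₁ ≤ c₂)
    (hhit : ∃ f ∈ S, o + c₂ • v ∈ f.carrier) :
    ∃ c, c₁ < c ∧ c ≤ c₂ ∧ (∃ t ∈ S, o + c • v ∈ t.carrier) ∧ Visible S o (o + c • v) := by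
  -- Searching from `c₁` on keeps the set closed and, when `0 < c₁`, allows `o` itself to lie on an
  -- element of `S`.
  let C : Set ℝ := Icc c₁ c₂ ∩ ⋃ f ∈ S, (fun c : ℝ => o + c • v) ⁻¹' f.carrier
  have hC : IsCompact C := by
    refine isCompact_Icc.inter_right (Set.Finite.isClosed_biUnion S.finite_toSet fun f _ => ?_)
    exact f.isClosed_carrier.preimage (by fun_prop)
  have hCne : C.Nonempty := by
    obtain ⟨f, hf, h⟩ := hhit
    exact ⟨c₂, ⟨h12, le_rfl⟩, mem_biUnion hf h⟩
  obtain ⟨c, hc, hmin⟩ := hC.exists_isLeast hCne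
  obtain ⟨t, ht, hct⟩ := mem_iUnion₂.1 hc.2
  have hlt : c₁ < c := lt_of_le_of_ne hc.1.1 (by rintro rfl; exact h1 t ht hct)
  refine ⟨c, hlt, hc.1.2, ⟨t, ht, hct⟩, Or.inr fun f hf => Set.disjoint_left.2 ?_⟩
  intro z hz hzf
  obtain ⟨l, hl0, hl1, rfl⟩ := mem_openSegment_iff.1 hz
  have e : o + l • (o + c • v - o) = o + (l * c) • v := by module
  rw [e] at hzf
  have hc0 : 0 < c := by linarith
  have hlc : l * c < c := by nlinarith
  rcases lt_or_ge (l * c) c₁ with h | h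
  · exact hfree _ (by positivity) h f hf hzf
  · exact absurd (hmin ⟨⟨h, by linarith [hc.1.2]⟩, mem_biUnion hf hzf⟩) (not_le.2 hlc)

/-- A segment that touches the line of sight to `x₀`, where the points next to `x₀` in direction
`d` are visible, does not extend to the side of `d`. -/
lemma sign_of_blocker {p x₀ d : Plane} {δ : ℝ} (hδ : 0 < δ)
    (hvis : ∀ ρ ∈ Ioo 0 δ, Visible S p (x₀ + ρ • d)) (hd : cross d (p - x₀) ≠ 0)
    {f : Seg} (hf : f ∈ S) {z g : Plane} (hz : z ∈ openSegment ℝ p x₀)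
    (hzg : segment ℝ z g ⊆ f.carrier) : 0 ≤ cross d (p - x₀) * cross (p - x₀) (g - z) := by
  by_contra hneg
  rw [not_le] at hneg
  obtain ⟨l, hl0, hl1, hzl⟩ := mem_openSegment_iff.1 hz
  -- If `g` were on the side of `d`, a point `z + m • (g - z)` with `m` small would lie on the sight
  -- line to `x₀ + ρ • d`. Cramer's rule in the basis `p - x₀`, `d` gives its relative position `l'`
  -- and the offset `ρ`, with `0 < ρ < δ` and `0 < l' < 1` for small `m`.
  set D := cross d (p - x₀) with hD
  set C := cross (p - x₀) (g - z) with hC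
  set E := cross d (g - z) with hE
  have hCD : 0 < -C / D := by
    have : -C / D = -(D * C) / (D * D) := by field_simp
    rw [this]
    exact div_pos (by linarith) (mul_self_pos.2 hd)
  have hl' : Tendsto (fun m : ℝ => l - m * (E / D)) (𝓝[>] 0) (𝓝 l) := by
    have : Continuous fun m : ℝ => l - m * (E / D) := by fun_prop
    simpa using (this.tendsto 0).mono_left nhdsWithin_le_nhds
  have hρ : Tendsto (fun m : ℝ => m * (-C / D) / (l - m * (E / D))) (𝓝[>] 0) (𝓝 0) := by
    have h1 : Tendsto (fun m : ℝ => m * (-C / D)) (𝓝[>] 0) (𝓝 0) := by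
      have : Continuous fun m : ℝ => m * (-C / D) := by fun_prop
      simpa using (this.tendsto 0).mono_left nhdsWithin_le_nhds
    have h2 := h1.div hl' hl0.ne'
    rw [zero_div] at h2
    exact h2
  have hI : ∀ᶠ m : ℝ in 𝓝[>] 0, m ∈ Ioo 0 1 := Ioo_mem_nhdsGT one_pos
  obtain ⟨m, ⟨⟨hm0, hm1⟩, hlm⟩, hρm⟩ := ((hI.and (hl'.eventually (Ioo_mem_nhds hl0 hl1))).and
    (hρ.eventually (Iio_mem_nhds hδ))).exists
  set l' := l - m * (E / D) with hl'def
  set ρ := m * (-C / D) / l' with hρdef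
  have hρ0 : 0 < ρ := div_pos (mul_pos hm0 hCD) hlm.1
  have hpx : p ≠ x₀ + ρ • d := by
    intro h
    apply hd
    have : p - x₀ = ρ • d := by rw [sub_eq_iff_eq_add, add_comm]; exact h
    rw [hD, this, cross_smul_right, cross_self, mul_zero]
  have hpt : z + m • (g - z) = p + l' • (x₀ + ρ • d - p) := by
    have hlρ : l' * ρ = m * (-C / D) := by rw [hρdef]; field_simp [hlm.1.ne']
    have h1 : D • (g - z) = E • (p - x₀) - C • d := by
      rw [hD, hE, hC]
      ext <;> simp only [cross, Prod.smul_fst, Prod.fst_sub, Prod.smul_snd, Prod.snd_sub, smul_eq_mul] <;> ring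
    have h2 : g - z = (E / D) • (p - x₀) - (C / D) • d := by
      rw [← inv_smul_smul₀ hd (g - z), h1]; module
    have h3 : p + l' • (x₀ + ρ • d - p) = p + l' • (x₀ - p) + (l' * ρ) • d := by module
    rw [h3, hlρ, h2, hzl, hl'def]
    module
  refine (hvis ρ ⟨hρ0, hρm⟩).notMem hpx (z := z + m • (g - z)) ?_ hf (hzg ?_)
  · rw [mem_openSegment_iff]; exact ⟨l', hlm.1, hlm.2, hpt⟩
  · rw [segment_eq_image']; exact ⟨m, ⟨hm0.le, hm1.le⟩, rfl⟩

/-- A segment that touches the line of sight at the end of a visible part, and is not collinear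
with it, does so with one of its endpoints, and goes away from the visible part. -/
lemma hasEnds_of_blocker {p x₀ d : Plane} {δ : ℝ} (hδ : 0 < δ)
    (hvis : ∀ ρ ∈ Ioo 0 δ, Visible S p (x₀ + ρ • d)) (hd : cross d (p - x₀) ≠ 0)
    {f : Seg} (hf : f ∈ S) {z : Plane} (hz : z ∈ openSegment ℝ p x₀) (hzf : z ∈ f.carrier)
    (hpf : cross f.dir (p - f.left) ≠ 0) :
    ∃ u, f.HasEnds z u ∧ 0 < cross d (p - x₀) * cross (p - x₀) (u - z) := by
  have hL := sign_of_blocker hδ hvis hd hf hz (f.convex_carrier.segment_subset hzf f.left_mem)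
  have hR := sign_of_blocker hδ hvis hd hf hz (f.convex_carrier.segment_subset hzf f.right_mem)
  obtain ⟨τ, h0, h1, rfl⟩ := Seg.mem_carrier.1 hzf
  obtain ⟨l, hl0, hl1, hzl⟩ := mem_openSegment_iff.1 hz
  -- The sign conditions at the two ends of `f` read `0 ≤ -τ * k` and `0 ≤ (1 - τ) * k`; as `k ≠ 0`,
  -- they force `τ` to be 0 or 1.
  set k := cross d (p - x₀) * cross (p - x₀) f.dir with hk
  have hkne : k ≠ 0 := by
    refine mul_ne_zero hd fun h => hpf ?_
    have e : p - f.left = (f.pt τ - f.left) + l • (p - x₀) := by rw [hzl]; module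
    rw [e, cross_add_right, Seg.cross_dir_pt, cross_smul_right, cross_swap, h]; simp
  have eL : cross d (p - x₀) * cross (p - x₀) (f.left - f.pt τ) = -τ * k := by
    have : f.left - f.pt τ = (-τ) • f.dir := by rw [Seg.pt_eq]; module
    rw [this, cross_smul_right, hk]; ring
  have eR : cross d (p - x₀) * cross (p - x₀) (f.right - f.pt τ) = (1 - τ) * k := by
    have : f.right - f.pt τ = (1 - τ) • f.dir := by rw [Seg.pt_eq, Seg.dir]; module
    rw [this, cross_smul_right, hk]; ring
  rw [eL] at hL
  rw [eR] at hR
  rcases lt_or_gt_of_ne hkne with hk0 | hk0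
  · obtain rfl : τ = 1 := le_antisymm h1 (by nlinarith)
    refine ⟨f.left, Or.inr ⟨f.pt_one, rfl⟩, ?_⟩
    rw [eL]; linarith
  · obtain rfl : τ = 0 := le_antisymm (by nlinarith) h0
    refine ⟨f.right, Or.inl ⟨f.pt_zero, rfl⟩, ?_⟩
    rw [eR]; linarith

/-! ### Triangles that contain a generic point -/

/-- `e` is an endpoint of an element of `S`. -/
def IsEnd (S : Finset Seg) (e : Plane) : Prop := ∃ f ∈ S, e = f.left ∨ e = f.right

lemma Seg.HasEnds.isEnd {f : Seg} (hf : f ∈ S) {q u : Plane} (h : f.HasEnds q u) : IsEnd S q :=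
  ⟨f, hf, h.imp And.left And.left⟩

/-- `p` is on no line through two endpoints of elements of `S`. -/
def Generic (S : Finset Seg) (p : Plane) : Prop :=
  ∀ e e' : Plane, IsEnd S e → IsEnd S e' → e ≠ e' → cross (e' - e) (p - e) ≠ 0

lemma Generic.off_line {p : Plane} (h : Generic S p) {f : Seg} (hf : f ∈ S) :
    cross f.dir (p - f.left) ≠ 0 :=
  h f.left f.right ⟨f, hf, Or.inl rfl⟩ ⟨f, hf, Or.inr rfl⟩ fun h => f.lt.ne (congrArg Prod.fst h)

/-- `p` is between the left endpoint of `s` and the point with parameter `r` of the far side `t`. -/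
def InitialWitness (S : Finset Seg) (s : Seg) (ε : ℝ) (t : Seg) (p : Plane) (r : ℝ) : Prop :=
  (0 ≤ r ∧ r ≤ 1) ∧ InitialEdge S s ε t r ∧ p ∈ openSegment ℝ s.left (t.pt r)

/-- `p` is on the active edge that starts at `q` when the sweep is at the parameter `r`. -/
def SweepWitness (S : Finset Seg) (s : Seg) (ε : ℝ) (q u : Plane) (t : Seg) (p : Plane) (r : ℝ) :
    Prop :=
  (0 ≤ r ∧ r ≤ 1) ∧ ActiveEdge S s ε q u t (s.pt r) ∧ ∃ c k : ℝ, 0 < k ∧ k ≤ c ∧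
    q + c • (q - s.pt r) ∈ t.carrier ∧ p = q + k • (q - s.pt r)

/-- One of the two kinds of triangles on the side `ε` is spanned along a line through `p`. -/
def Witness (S : Finset Seg) (s : Seg) (ε : ℝ) (p : Plane) : Prop :=
  (∃ t ∈ S, ∃ r, InitialWitness S s ε t p r) ∨
    ∃ f ∈ S, ∃ t ∈ S, (∃ r, SweepWitness S s ε f.left f.right t p r) ∨
      ∃ r, SweepWitness S s ε f.right f.left t p r

lemma exists_sign {x : ℝ} (hx : x ≠ 0) : ∃ ε : ℝ, (ε = 1 ∨ ε = -1) ∧ 0 < ε * x := by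
  rcases lt_or_gt_of_ne hx with h | h
  · exact ⟨-1, Or.inr rfl, by linarith⟩
  · exact ⟨1, Or.inl rfl, by linarith⟩

lemma not_visible_iff {p q : Plane} : ¬ Visible S p q ↔
    p ≠ q ∧ ∃ f ∈ S, ∃ z ∈ openSegment ℝ p q, z ∈ f.carrier := by
  simp only [Visible, not_or, Set.disjoint_left, not_forall, not_not, exists_prop]

lemma Frame.exists_hit_beyond (F : Frame S R) {o p : Plane} (hp : p ∈ interior R) (hop : o ≠ p)
    (hpS : ∀ f ∈ S, p ∉ f.carrier)
    (hfree : ∀ c : ℝ, 0 < c → c < 1 → ∀ f ∈ S, o + c • (p - o) ∉ f.carrier) :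
    ∃ c : ℝ, 1 < c ∧ (∃ t ∈ S, o + c • (p - o) ∈ t.carrier) ∧ Visible S o (o + c • (p - o)) := by
  obtain ⟨c₂, hc₂, f, hf, hhit⟩ := F.hit p hp (p - o) (sub_ne_zero.2 hop.symm)
  obtain ⟨c, hc, -, h1, h2⟩ := exists_first_hit S (o := o) (v := p - o) (c₁ := 1) (c₂ := 1 + c₂)
    zero_le_one hfree (by simpa using hpS) (by linarith)
    ⟨f, hf, by convert hhit using 1; module⟩
  exact ⟨c, hc, h1, h2⟩

/-- Look at the left end `x` of a visible part. If `x` is visible, it is the left endpoint of `s`,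
and the ray from it through `p` runs on to the far side of an initial triangle. Otherwise every
element touching the open sight line does so at an endpoint and turns away from the visible part. By
genericity there is only one such point `z`, and the active edge from `z` contains `p`. -/
lemma Frame.exists_witness (F : Frame S R) {p : Plane} (hp : p ∈ interior R) (hG : Generic S p)
    {s : Seg} (hs : s ∈ S) (hv : SegVisible S s p) : Witness S s 1 p ∨ Witness S s (-1) p := by
  suffices h : ∃ ε : ℝ, (ε = 1 ∨ ε = -1) ∧ Witness S s ε p by
    rcases h with ⟨ε, rfl | rfl, h⟩
    exacts [Or.inl h, Or.inr h]
  have hpS : ∀ f ∈ S, p ∉ f.carrier := fun f hf h => hG.off_line hf (Seg.cross_dir_of_mem h)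
  have hps := hG.off_line hs
  obtain ⟨ε, hε, hside⟩ := exists_sign hps
  refine ⟨ε, hε, ?_⟩
  obtain ⟨a, b, hab⟩ := F.exists_piece hp hpS hs hps hv
  have h0 := hab.1
  have hlt := hab.2.1
  have h1 := hab.2.2.1
  by_cases ha : Visible S p (s.pt a)
  · left
    obtain rfl := F.piece_left hp hpS hs hps hab ha
    rw [Seg.pt_zero] at ha
    have hne : s.left ≠ p := fun h => hpS s hs (h ▸ s.left_mem)
    obtain ⟨c, hc, ⟨t, ht, hct⟩, hvis⟩ := F.exists_hit_beyond hp hne hpS fun c hc0 hc1 f hf =>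
      ha.symm.notMem hne (mem_openSegment_iff.2 ⟨c, hc0, hc1, rfl⟩) hf
    obtain ⟨r, hr0, hr1, hr⟩ := Seg.mem_carrier.1 hct
    refine ⟨t, ht, r, ⟨hr0, hr1⟩, ⟨?_, hr ▸ hvis⟩, ?_⟩
    · rw [onSide_iff, ← hr, add_sub_cancel_left, cross_smul_right]
      have : 0 < c * (ε * cross s.dir (p - s.left)) := mul_pos (by linarith) hside
      linarith
    · rw [← hr, mem_openSegment_iff]
      refine ⟨c⁻¹, by positivity, inv_lt_one_of_one_lt₀ hc, ?_⟩
      rw [add_sub_cancel_left, inv_smul_smul₀ (by linarith)]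
      module
  · right
    set x := s.pt a with hx
    obtain ⟨hpx, f, hf, z, hz, hzf⟩ := not_visible_iff.1 ha
    have hD : cross s.dir (p - x) = cross s.dir (p - s.left) := by
      rw [hx, cross_off_pt, cross_self, mul_zero, sub_zero]
    have hends : ∀ g ∈ S, ∀ y ∈ openSegment ℝ p x, y ∈ g.carrier →
        ∃ u, g.HasEnds y u ∧ 0 < cross s.dir (p - x) * cross (p - x) (u - y) := by
      intro g hg y hy hyg
      refine hasEnds_of_blocker (sub_pos.2 hlt) ?_ (hD ▸ hps) hg hy hyg (hG.off_line hg)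
      rintro ρ ⟨hρ0, hρ1⟩
      have := hab.2.2.2.1 (a + ρ) ⟨by linarith, by linarith⟩
      convert this using 1
      rw [hx, Seg.pt_eq, Seg.pt_eq]; module
    obtain ⟨u, hzu, hsign⟩ := hends f hf z hz hzf
    -- Two different blocking endpoints would be collinear with `p`.
    have huniq : ∀ g ∈ S, ∀ y ∈ openSegment ℝ p x, y ∈ g.carrier → y = z := by
      intro g hg y hy hyg
      by_contra hyz
      obtain ⟨u', hyu', -⟩ := hends g hg y hy hyg
      apply hG y z (hyu'.isEnd hg) (hzu.isEnd hf) hyz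
      obtain ⟨l, -, -, rfl⟩ := mem_openSegment_iff.1 hy
      obtain ⟨l', -, -, rfl⟩ := mem_openSegment_iff.1 hz
      have e1 : p + l' • (x - p) - (p + l • (x - p)) = (l' - l) • (x - p) := by module
      have e2 : p - (p + l • (x - p)) = (-l) • (x - p) := by module
      rw [e1, e2, cross_smul_left, cross_smul_right, cross_self]; ring
    obtain ⟨l, hl0, hl1, hzl⟩ := mem_openSegment_iff.1 hz
    have hinj : ∀ l' : ℝ, p + l' • (x - p) = z → l' = l := by
      intro l' h
      rw [hzl, add_right_inj] at h
      exact smul_left_injective ℝ (sub_ne_zero.2 hpx.symm) h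
    have hvxz : Visible S x z := by
      refine Or.inr fun g hg => Set.disjoint_left.2 fun y hy hyg => ?_
      obtain ⟨m, hm0, hm1, rfl⟩ := mem_openSegment_iff.1 hy
      have e : x + m • (z - x) = p + (1 - m * (1 - l)) • (x - p) := by rw [hzl]; module
      have hml : 0 < m * (1 - l) := mul_pos hm0 (by linarith)
      have hml' : 0 < (1 - m) * (1 - l) := mul_pos (by linarith) (by linarith)
      have hy' : x + m • (z - x) ∈ openSegment ℝ p x :=
        mem_openSegment_iff.2 ⟨_, by linarith, by linarith, e⟩
      have := hinj _ (e ▸ huniq g hg _ hy' hyg)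
      linarith
    have hzp : z ≠ p := by
      intro h
      have := hinj 0 (by rw [h]; module)
      linarith
    obtain ⟨c, hc, ⟨t, ht, hct⟩, hvis⟩ := F.exists_hit_beyond hp hzp hpS fun c hc0 hc1 g hg hyg => by
      have e : z + c • (p - z) = p + (l * (1 - c)) • (x - p) := by rw [hzl]; module
      have h3 : 0 < l * (1 - c) := mul_pos hl0 (by linarith)
      have h4 : 0 < l * c := mul_pos hl0 hc0
      have hy' : z + c • (p - z) ∈ openSegment ℝ p x :=
        mem_openSegment_iff.2 ⟨_, h3, by linarith, e⟩
      have := hinj _ (e ▸ huniq g hg _ hy' hyg)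
      linarith
    have h1l : 0 < 1 - l := by linarith
    have hk : 0 < l / (1 - l) := div_pos hl0 h1l
    -- `l / (1 - l)` is the ratio in which `z` divides the segment from `p` to `x`; it converts
    -- multiples of `p - z` into multiples of `z - x`.
    have hpz : p - z = (l / (1 - l)) • (z - x) := by
      have e1 : p - z = l • (p - x) := by rw [hzl]; module
      have e2 : z - x = (1 - l) • (p - x) := by rw [hzl]; module
      rw [e1, e2, smul_smul, div_mul_cancel₀ _ h1l.ne']
    have hcz : z + c • (p - z) = z + (c * (l / (1 - l))) • (z - x) := by
      rw [hpz, smul_smul]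
    have hW : SweepWitness S s ε z u t p a := by
      refine ⟨⟨h0, by linarith⟩, ⟨?_, hvxz, ?_, ?_⟩, ?_⟩
      · have e : z - s.left = (1 - l) • (p - s.left) + l • (x - s.left) := by rw [hzl]; module
        rw [onSide_iff, e, cross_add_right, cross_smul_right, cross_smul_right, hx,
          Seg.cross_dir_pt]
        have := mul_pos h1l hside
        linarith
      · have e2 : z - x = (1 - l) • (p - x) := by rw [hzl]; module
        rw [← hx, e2, cross_smul_left]
        rw [hD] at hsign
        have : 0 < ε * cross (p - x) (u - z) := by
          rcases hε with rfl | rfl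
          · have := (mul_pos_iff_of_pos_left (by linarith)).1 hsign
            linarith
          · have := (mul_pos_iff.1 hsign).resolve_left (by
              rintro ⟨h, -⟩; linarith)
            linarith [this.2]
        have := mul_pos h1l this
        linarith
      · exact ⟨c * (l / (1 - l)), by positivity, hcz ▸ hct, hcz ▸ hvis⟩
      · refine ⟨c * (l / (1 - l)), l / (1 - l), hk, by nlinarith, hcz ▸ hct, ?_⟩
        rw [← hpz]; module
    refine ⟨f, hf, t, ht, ?_⟩
    rcases hzu with ⟨rfl, rfl⟩ | ⟨rfl, rfl⟩
    · exact Or.inl ⟨a, hW⟩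
    · exact Or.inr ⟨a, hW⟩

/-! ### Triangles that contain limits of generic points -/

/-- The factor `c` is a continuous function `C` of the hit point, so the set is the projection of a
compact subset of parameters times `t`. The closed condition `0 ≤ C` suffices, since `C = 0` would
put `q` on `t`. -/
lemma isClosed_hits {s t : Seg} {q : Plane} (hq : cross s.dir (q - s.left) ≠ 0)
    (hqt : cross t.dir (q - t.left) ≠ 0) (x y : ℝ) :
    IsClosed {r | r ∈ Icc x y ∧ ∃ c : ℝ, 0 < c ∧ q + c • (q - s.pt r) ∈ t.carrier} := by
  set D := cross s.dir (q - s.left) with hD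
  let C : Plane → ℝ := fun w => cross s.dir (w - q) / D
  have hC : Continuous C := by
    have : Continuous fun w : Plane => cross s.dir (w - q) := by fun_prop
    exact this.div_const D
  have hCr : ∀ (c r : ℝ), C (q + c • (q - s.pt r)) = c := by
    intro c r
    simp only [C]
    rw [add_sub_cancel_left, cross_smul_right, cross_off_pt, cross_self, mul_zero, sub_zero,
      ← hD, mul_div_cancel_right₀ _ hq]
  have hK : IsCompact ((Icc x y ×ˢ t.carrier) ∩
      {z : ℝ × Plane | z.2 = q + C z.2 • (q - s.pt z.1) ∧ 0 ≤ C z.2}) := by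
    have e1 : IsClosed {z : ℝ × Plane | z.2 = q + C z.2 • (q - s.pt z.1)} :=
      isClosed_eq (by fun_prop) (by fun_prop)
    have e2 : IsClosed {z : ℝ × Plane | 0 ≤ C z.2} := isClosed_le (by fun_prop) (by fun_prop)
    exact (isCompact_Icc.prod t.isCompact_carrier).inter_right (e1.inter e2)
  convert (hK.image continuous_fst).isClosed using 1
  ext r
  constructor
  · rintro ⟨hr, c, hc, hw⟩
    refine ⟨(r, q + c • (q - s.pt r)), ⟨⟨hr, hw⟩, ?_⟩, rfl⟩
    simp only [mem_ofPred_eq]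
    rw [hCr]
    exact ⟨rfl, hc.le⟩
  · rintro ⟨⟨r', w⟩, ⟨⟨hr, hw⟩, h, hc⟩, rfl⟩
    refine ⟨hr, C w, lt_of_le_of_ne hc ?_, ?_⟩
    · intro h0
      simp only at h
      rw [← h0, zero_smul, add_zero] at h
      rw [h] at hw
      exact hqt (Seg.cross_dir_of_mem hw)
    · simp only at h hw
      rwa [← h]

/-- The edge need not be active at `a` and `b`, but the far corners of its sweep triangle exist
because hitting `t` is a closed condition. -/
lemma exists_hit_endpoints {s t : Seg} {q : Plane} (hq : cross s.dir (q - s.left) ≠ 0)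
    (hqt : cross t.dir (q - t.left) ≠ 0) {a b : ℝ} (hab : a < b)
    (h : ∀ r ∈ Ioo a b, ∃ c : ℝ, 0 < c ∧ q + c • (q - s.pt r) ∈ t.carrier) :
    (∃ c : ℝ, 0 < c ∧ q + c • (q - s.pt a) ∈ t.carrier) ∧
      ∃ c : ℝ, 0 < c ∧ q + c • (q - s.pt b) ∈ t.carrier := by
  have hsub : Ioo a b ⊆ {r | r ∈ Icc a b ∧ ∃ c : ℝ, 0 < c ∧ q + c • (q - s.pt r) ∈ t.carrier} :=
    fun r hr => ⟨Ioo_subset_Icc_self hr, h r hr⟩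
  have := (isClosed_hits hq hqt a b).closure_subset_iff.2 hsub
  rw [closure_Ioo hab.ne] at this
  exact ⟨(this ⟨le_rfl, hab.le⟩).2, (this ⟨hab.le, le_rfl⟩).2⟩

lemma combo_hit (s : Seg) (q : Plane) {a b r α β : ℝ} (hD : α * (r - a) + β * (b - r) ≠ 0) :
    ∃ c : ℝ, (1 - α * (r - a) / (α * (r - a) + β * (b - r))) • (q + α • (q - s.pt a)) +
      (α * (r - a) / (α * (r - a) + β * (b - r))) • (q + β • (q - s.pt b)) =
        q + c • (q - s.pt r) := by
  set D := α * (r - a) + β * (b - r) with hDdef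
  refine ⟨(1 - α * (r - a) / D) * α + α * (r - a) / D * β, ?_⟩
  have hkey : (1 - α * (r - a) / D) * α * (r - a) = α * (r - a) / D * β * (b - r) := by
    field_simp
    rw [hDdef]; ring
  simp only [Seg.pt_eq]
  ext
  · simp only [Prod.fst_add, Prod.smul_fst, Prod.fst_sub, smul_eq_mul]
    linear_combination s.dir.1 * hkey
  · simp only [Prod.snd_add, Prod.smul_snd, Prod.snd_sub, smul_eq_mul]
    linear_combination s.dir.2 * hkey

lemma mem_convexHull_of_segment {o A B w z : Plane} (hw : w ∈ segment ℝ A B)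
    (hz : z ∈ segment ℝ o w) : z ∈ convexHull ℝ {o, A, B} := by
  have hsub := subset_convexHull ℝ ({o, A, B} : Set Plane)
  have hc := convex_convexHull ℝ ({o, A, B} : Set Plane)
  have hw' := hc.segment_subset (hsub (by simp)) (hsub (by simp)) hw
  exact hc.segment_subset (hsub (by simp)) hw' hz

/-- The far side joining the two corners lies in `t`, and the ray for `r` crosses it. As the ray
meets `t` only once, the crossing is the hit at `c`, and every point from `q` to it is in the
triangle. -/
lemma mem_sweep_triangle {s t : Seg} {q : Plane} (hqt : cross t.dir (q - t.left) ≠ 0)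
    {a b r α β c k : ℝ} (hr : r ∈ Ioo a b) (hα : 0 < α) (hβ : 0 < β)
    (hA : q + α • (q - s.pt a) ∈ t.carrier) (hB : q + β • (q - s.pt b) ∈ t.carrier)
    (hk : 0 < k) (hkc : k ≤ c) (hw : q + c • (q - s.pt r) ∈ t.carrier) :
    q + k • (q - s.pt r) ∈ convexHull ℝ {q, q + α • (q - s.pt a), q + β • (q - s.pt b)} := by
  have h1 : 0 < α * (r - a) := mul_pos hα (sub_pos.2 hr.1)
  have h2 : 0 < β * (b - r) := mul_pos hβ (sub_pos.2 hr.2)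
  obtain ⟨c', hc'⟩ := combo_hit s q (a := a) (b := b) (r := r) (α := α) (β := β) (by positivity)
  have hle : α * (r - a) / (α * (r - a) + β * (b - r)) ≤ 1 :=
    (div_le_one (by positivity)).2 (by linarith)
  have hseg : q + c' • (q - s.pt r) ∈ segment ℝ (q + α • (q - s.pt a)) (q + β • (q - s.pt b)) := by
    rw [← hc']
    exact ⟨_, _, sub_nonneg.2 hle, by positivity, by ring, rfl⟩
  have hcc : c' = c := hit_unique hqt (t.convex_carrier.segment_subset hA hB hseg) hw
  rw [hcc] at hseg
  refine mem_convexHull_of_segment hseg ?_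
  rw [segment_eq_image']
  have hc : 0 < c := hk.trans_le hkc
  refine ⟨k / c, ⟨by positivity, (div_le_one hc).2 hkc⟩, ?_⟩
  simp only
  rw [add_sub_cancel_left, smul_smul, div_mul_cancel₀ _ hc.ne']

lemma isClosed_triangle (o A B : Plane) : IsClosed (convexHull ℝ {o, A, B}) :=
  (Set.Finite.isCompact_convexHull ℝ (Set.toFinite {o, A, B})).isClosed

section Limit

variable {U : Ultrafilter ℝ} {p' : ℝ → Plane} {p : Plane}

lemma exists_limit_param {P : ℝ → ℝ → Prop} (h : ∀ᶠ x in U, ∃ r, P x r)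
    (h01 : ∀ x r, P x r → 0 ≤ r ∧ r ≤ 1) :
    ∃ (r : ℝ → ℝ) (r₀ : ℝ), (∀ᶠ x in U, P x (r x)) ∧ Tendsto r U (𝓝 r₀) := by
  obtain ⟨r, hr⟩ := h.choice
  have : ((U.map r : Ultrafilter ℝ) : Filter ℝ) ≤ 𝓟 (Icc 0 1) := by
    rw [le_principal_iff]
    exact hr.mono fun x hx => h01 _ _ hx
  obtain ⟨r₀, -, hr₀⟩ := isCompact_Icc.ultrafilter_le_nhds _ this
  exact ⟨r, r₀, hr, hr₀⟩

/-- A single witness parameter need not lie inside a maximal interval. Parameters that converge to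
`r₀` without being equal to it eventually do, in one common interval, by tameness. The triangle over
it contains the approximating points and is closed. -/
lemma exists_initialTriangle_of_limit (hp : Tendsto p' U (𝓝 p))
    (havoid : ∀ e d : Plane, d ≠ 0 → ∀ᶠ x in U, cross d (p' x - e) ≠ 0) {s t : Seg} (ht : t ∈ S)
    {ε : ℝ} (h : ∀ᶠ x in U, ∃ r, InitialWitness S s ε t (p' x) r) :
    ∃ Δ ∈ initialTriangles S s ε, p ∈ Δ := by
  obtain ⟨r, r₀, hr, hr₀⟩ := exists_limit_param h fun _ _ h => h.1
  -- At the parameter `r₀`, the point `p' x` would lie on one fixed line, which is eventually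
  -- avoided.
  have hne : ∀ᶠ x in U, r x ≠ r₀ := by
    by_cases h0 : t.pt r₀ = s.left
    · filter_upwards [hr] with x hx hxr
      have := hx.2.1.1.cross_ne
      rw [hxr, h0, sub_self] at this
      exact this (cross_zero_right _)
    · filter_upwards [hr, havoid s.left _ (sub_ne_zero.2 h0)] with x hx hx' hxr
      obtain ⟨l, -, -, hl⟩ := mem_openSegment_iff.1 hx.2.2
      apply hx'
      rw [hl, hxr, add_sub_cancel_left, cross_smul_right, cross_self, mul_zero]
  obtain ⟨a, b, hab, hmem⟩ := (tame_initialEdge S s ε t).exists_isMaxInterval hr₀ hne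
    (hr.mono fun x hx => hx.2.1) (hr.mono fun x hx => hx.1)
  refine ⟨_, ⟨t, ht, a, b, hab, rfl⟩, ?_⟩
  refine (isClosed_triangle _ _ _).mem_of_tendsto hp ?_
  filter_upwards [hr, hmem] with x hx hx'
  refine mem_convexHull_of_segment (w := t.pt (r x)) ?_ (openSegment_subset_segment _ _ _ hx.2.2)
  have hba : 0 < b - a := by linarith [hx'.1, hx'.2]
  rw [segment_eq_image']
  refine ⟨(r x - a) / (b - a), ⟨div_nonneg (by linarith [hx'.1]) hba.le,
    (div_le_one hba).2 (by linarith [hx'.2])⟩, ?_⟩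
  simp only [Seg.pt_eq]
  have : t.left + b • t.dir - (t.left + a • t.dir) = (b - a) • t.dir := by module
  rw [this, smul_smul, div_mul_cancel₀ _ hba.ne']
  module

lemma exists_sweepTriangle_of_limit (hp : Tendsto p' U (𝓝 p))
    (havoid : ∀ e d : Plane, d ≠ 0 → ∀ᶠ x in U, cross d (p' x - e) ≠ 0) {s f t : Seg} (hf : f ∈ S)
    {q u : Plane} (hqu : f.HasEnds q u) (ht : t ∈ S)
    {ε : ℝ} (h : ∀ᶠ x in U, ∃ r, SweepWitness S s ε q u t (p' x) r) :
    ∃ Δ ∈ sweepTriangles S s ε, p ∈ Δ := by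
  obtain ⟨r, r₀, hr, hr₀⟩ := exists_limit_param h fun _ _ h => h.1
  have hq : cross s.dir (q - s.left) ≠ 0 := by
    obtain ⟨x, hx⟩ := hr.exists
    exact hx.2.1.1.cross_ne
  have hne : ∀ᶠ x in U, r x ≠ r₀ := by
    have h0 : q ≠ s.pt r₀ := by
      rintro rfl
      exact hq (Seg.cross_dir_pt _ _)
    filter_upwards [hr, havoid q _ (sub_ne_zero.2 h0)] with x hx hx' hxr
    obtain ⟨c, k, -, -, -, hk⟩ := hx.2.2
    apply hx'
    rw [hk, hxr, add_sub_cancel_left, cross_smul_right, cross_self, mul_zero]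
  obtain ⟨a, b, hab, hmem⟩ := (tame_activeEdge S s ε q u t).exists_isMaxInterval hr₀ hne
    (hr.mono fun x hx => hx.2.1) (hr.mono fun x hx => hx.1)
  have hhit : ∀ r ∈ Ioo a b, ∃ c : ℝ, 0 < c ∧ q + c • (q - s.pt r) ∈ t.carrier := by
    intro r hr
    obtain ⟨-, -, -, c, hc, hw, -⟩ := hab.2.2.2.1 r hr
    exact ⟨c, hc, hw⟩
  have hqt : cross t.dir (q - t.left) ≠ 0 := by
    obtain ⟨r₁, h₁⟩ := exists_between hab.2.1
    obtain ⟨r₂, h₂⟩ := exists_between h₁.2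
    obtain ⟨c₁, hc₁, hw₁⟩ := hhit r₁ h₁
    obtain ⟨c₂, hc₂, hw₂⟩ := hhit r₂ ⟨h₁.1.trans h₂.1, h₂.2⟩
    exact off_line_of_two_hits hq h₂.1.ne hc₁ hc₂ hw₁ hw₂
  obtain ⟨⟨α, hα, hA⟩, β, hβ, hB⟩ := exists_hit_endpoints hq hqt hab.2.1 hhit
  refine ⟨_, ⟨f, hf, q, u, hqu, t, ht, a, b, hab, α, β, hα, hβ, hA, hB, rfl⟩, ?_⟩
  refine (isClosed_triangle _ _ _).mem_of_tendsto hp ?_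
  filter_upwards [hr, hmem] with x hx hx'
  obtain ⟨c, k, hk, hkc, hw, e⟩ := hx.2.2
  rw [e]
  exact mem_sweep_triangle hqt hx' hα hβ hA hB hk hkc hw

lemma exists_triangle_of_limit (hp : Tendsto p' U (𝓝 p))
    (havoid : ∀ e d : Plane, d ≠ 0 → ∀ᶠ x in U, cross d (p' x - e) ≠ 0) {s : Seg}
    {ε : ℝ} (h : ∀ᶠ x in U, Witness S s ε (p' x)) :
    ∃ Δ ∈ initialTriangles S s ε ∪ sweepTriangles S s ε, p ∈ Δ := by
  rcases Ultrafilter.eventually_or.1 h with h | h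
  · obtain ⟨t, ht, h⟩ := (Ultrafilter.eventually_exists_mem_iff S.finite_toSet).1 h
    obtain ⟨Δ, hΔ, hpΔ⟩ := exists_initialTriangle_of_limit hp havoid ht h
    exact ⟨Δ, Or.inl hΔ, hpΔ⟩
  · obtain ⟨f, hf, h⟩ := (Ultrafilter.eventually_exists_mem_iff S.finite_toSet).1 h
    obtain ⟨t, ht, h⟩ := (Ultrafilter.eventually_exists_mem_iff S.finite_toSet).1 h
    rcases Ultrafilter.eventually_or.1 h with h | h
    · obtain ⟨Δ, hΔ, hpΔ⟩ :=
        exists_sweepTriangle_of_limit hp havoid hf (Or.inl ⟨rfl, rfl⟩) ht h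
      exact ⟨Δ, Or.inr hΔ, hpΔ⟩
    · obtain ⟨Δ, hΔ, hpΔ⟩ :=
        exists_sweepTriangle_of_limit hp havoid hf (Or.inr ⟨rfl, rfl⟩) ht h
      exact ⟨Δ, Or.inr hΔ, hpΔ⟩

end Limit

/-! ### Generic points converging to `p` -/

/-- A curve through `p` that meets every line in isolated points. -/
def arc (p : Plane) (x : ℝ) : Plane := p + (x, x ^ 2)

lemma tendsto_arc (p : Plane) : Tendsto (arc p) (𝓝[>] 0) (𝓝 p) := by
  have : Continuous (arc p) := by unfold arc; fun_prop
  have h := (this.tendsto 0).mono_left (nhdsWithin_le_nhds (s := Ioi 0))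
  have e : arc p 0 = p := by ext <;> simp [arc]
  rwa [e] at h

/-- Along the arc the determinant is a polynomial with linear and quadratic coefficients `-d.2` and
`d.1`. It is not zero, so it has finitely many roots. -/
lemma arc_avoids (p e d : Plane) (hd : d ≠ 0) : ∀ᶠ x in 𝓝[>] (0 : ℝ), cross d (arc p x - e) ≠ 0 := by
  have hpoly : ∀ x : ℝ, cross d (arc p x - e) =
      (Polynomial.C (cross d (p - e)) + Polynomial.C (-d.2) * Polynomial.X +
        Polynomial.C d.1 * Polynomial.X ^ 2).eval x := by
    intro x
    simp [cross, arc]; ring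
  set P : Polynomial ℝ := Polynomial.C (cross d (p - e)) + Polynomial.C (-d.2) * Polynomial.X +
        Polynomial.C d.1 * Polynomial.X ^ 2 with hP
  have hP0 : P ≠ 0 := by
    intro h
    apply hd
    have h1 := congrArg (fun Q : Polynomial ℝ => Q.coeff 1) h
    have h2 := congrArg (fun Q : Polynomial ℝ => Q.coeff 2) h
    simp [hP, Polynomial.coeff_C] at h1 h2
    exact Prod.ext h2 h1
  have hfin : {x | P.IsRoot x}.Finite := Polynomial.finite_setOfPred_isRoot hP0
  have : ∀ᶠ x in 𝓝[>] (0 : ℝ), x ∉ {x | P.IsRoot x} := by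
    have h1 := (hfin.subset (sdiff_subset : {x | P.IsRoot x} \ {0} ⊆ _)).isClosed.isOpen_compl.mem_nhds
      (x := 0) (by simp)
    filter_upwards [nhdsWithin_le_nhds h1, self_mem_nhdsWithin] with x hx hx0 hxr
    exact hx ⟨hxr, (ne_of_gt hx0 : x ≠ 0)⟩
  filter_upwards [this] with x hx h
  exact hx (by
    change P.eval x = 0
    rw [← hpoly]; exact h)

lemma arc_generic (S : Finset Seg) (p : Plane) : ∀ᶠ x in 𝓝[>] (0 : ℝ), Generic S (arc p x) := by
  have hfin : {e | IsEnd S e}.Finite := by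
    have : {e | IsEnd S e} = Seg.left '' S ∪ Seg.right '' S := by
      ext e
      simp only [IsEnd, mem_ofPred_eq, mem_union, mem_image, SetLike.mem_coe]
      constructor
      · rintro ⟨f, hf, rfl | rfl⟩
        exacts [Or.inl ⟨f, hf, rfl⟩, Or.inr ⟨f, hf, rfl⟩]
      · rintro (⟨f, hf, rfl⟩ | ⟨f, hf, rfl⟩)
        exacts [⟨f, hf, Or.inl rfl⟩, ⟨f, hf, Or.inr rfl⟩]
    rw [this]
    exact (S.finite_toSet.image _).union (S.finite_toSet.image _)
  have h : ∀ᶠ x in 𝓝[>] (0 : ℝ), ∀ e ∈ {e | IsEnd S e}, ∀ e' ∈ {e | IsEnd S e}, e ≠ e' →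
      cross (e' - e) (arc p x - e) ≠ 0 := by
    rw [eventually_all_finite hfin]
    intro e _
    rw [eventually_all_finite hfin]
    intro e' _
    by_cases hee : e = e'
    · exact Eventually.of_forall fun x h => absurd hee h
    · filter_upwards [arc_avoids p e (e' - e) (sub_ne_zero.2 (Ne.symm hee))] with x hx _ using hx
  filter_upwards [h] with x hx e e' he he' hne using hx e he e' he' hne

/-- If `s` is visible from points of the arc arbitrarily close to `p`, then some triangle of
the covering of `s` contains `p`. -/
lemma Frame.exists_triangle (F : Frame S R) {p : Plane} (hp : p ∈ interior R) {s : Seg} (hs : s ∈ S)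
    (h : ∃ᶠ x in 𝓝[>] (0 : ℝ), SegVisible S s (arc p x)) : ∃ Δ ∈ cover S s, p ∈ Δ := by
  have hR : ∀ᶠ x in 𝓝[>] (0 : ℝ), arc p x ∈ interior R :=
    tendsto_arc p (isOpen_interior.mem_nhds hp)
  have h' : ∃ᶠ x in 𝓝[>] (0 : ℝ), Witness S s 1 (arc p x) ∨ Witness S s (-1) (arc p x) := by
    refine (h.and_eventually (hR.and (arc_generic S p))).mono ?_
    rintro x ⟨hx, hxR, hxG⟩
    exact F.exists_witness hxR hxG hs hx
  have := frequently_iff_neBot.1 h'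
  -- Refining to an ultrafilter turns "frequently" into "eventually" and selects the side, the kind
  -- of triangle and the segments involved.
  obtain ⟨U, hU'⟩ := Filter.exists_ultrafilter_le
    (𝓝[>] (0 : ℝ) ⊓ 𝓟 {x | Witness S s 1 (arc p x) ∨ Witness S s (-1) (arc p x)})
  have hU : (U : Filter ℝ) ≤ 𝓝[>] 0 := hU'.trans inf_le_left
  have hUW : ∀ᶠ x in U, Witness S s 1 (arc p x) ∨ Witness S s (-1) (arc p x) :=
    le_principal_iff.1 (hU'.trans inf_le_right)
  have ht := (tendsto_arc p).mono_left hU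
  have hav : ∀ e d : Plane, d ≠ 0 → ∀ᶠ x in U, cross d (arc p x - e) ≠ 0 := fun e d hd =>
    hU (arc_avoids p e d hd)
  rcases Ultrafilter.eventually_or.1 hUW with h | h
  · obtain ⟨Δ, hΔ, hpΔ⟩ := exists_triangle_of_limit ht hav h
    exact ⟨Δ, Or.inl hΔ, hpΔ⟩
  · obtain ⟨Δ, hΔ, hpΔ⟩ := exists_triangle_of_limit ht hav h
    exact ⟨Δ, Or.inr hΔ, hpΔ⟩

/-! ### From triangles to visible parts -/

/-- An interior point can be moved slightly away from the centroid `g` within the triangle. Writing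
`p` as a mean of the moved point and `g` makes all three barycentric weights positive. -/
lemma weights_of_mem_interior {o A B p : Plane} (hp : p ∈ interior (convexHull ℝ {o, A, B})) :
    ∃ y z : ℝ, 0 < y ∧ 0 < z ∧ y + z < 1 ∧ p = o + y • (A - o) + z • (B - o) := by
  have hT : ∀ w ∈ convexHull ℝ {o, A, B}, ∃ y z : ℝ, 0 ≤ y ∧ 0 ≤ z ∧ y + z ≤ 1 ∧
      w = o + y • (A - o) + z • (B - o) := by
    intro w hw
    rw [convexHull_insert (by simp), convexHull_pair, mem_convexJoin] at hw
    obtain ⟨_, rfl, v, hv, hw⟩ := hw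
    rw [segment_eq_image'] at hv hw
    obtain ⟨m, ⟨hm0, hm1⟩, rfl⟩ := hv
    obtain ⟨l, ⟨hl0, hl1⟩, rfl⟩ := hw
    refine ⟨l * (1 - m), l * m, mul_nonneg hl0 (by linarith), mul_nonneg hl0 hm0, by linarith, ?_⟩
    simp only
    module
  set g : Plane := o + (1 / 3 : ℝ) • (A - o) + (1 / 3 : ℝ) • (B - o) with hg
  have hc : Continuous fun x : ℝ => p + x • (p - g) := by fun_prop
  have h0 : ∀ᶠ x in 𝓝[>] (0 : ℝ), p + x • (p - g) ∈ interior (convexHull ℝ {o, A, B}) := by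
    refine nhdsWithin_le_nhds (hc.continuousAt.eventually (isOpen_interior.mem_nhds ?_))
    simpa using hp
  obtain ⟨x, hx, hx0⟩ := (h0.and self_mem_nhdsWithin).exists
  have hx0 : 0 < x := hx0
  obtain ⟨y, z, hy, hz, hyz, he⟩ := hT _ (interior_subset hx)
  refine ⟨(y + x / 3) / (1 + x), (z + x / 3) / (1 + x), by positivity, by positivity, ?_, ?_⟩
  · rw [← add_div, div_lt_one (by positivity)]
    linarith
  · have h1 : p = (1 + x)⁻¹ • (p + x • (p - g) + x • g) := by
      have : p + x • (p - g) + x • g = (1 + x) • p := by module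
      rw [this, inv_smul_smul₀ (by positivity)]
    rw [he, hg] at h1
    rw [h1]
    have hne : 1 + x ≠ 0 := by positivity
    ext <;> simp only [Prod.fst_add, Prod.smul_fst, Prod.fst_sub, Prod.snd_add, Prod.smul_snd,
      Prod.snd_sub, smul_eq_mul] <;> field_simp <;> ring

/-- `Δ` is the initial triangle that contains `p` in its interior. -/
def InitialAt (S : Finset Seg) (s : Seg) (ε : ℝ) (Δ : Set Plane) (p : Plane) : Prop :=
  ∃ t ∈ S, ∃ a b r : ℝ, IsMaxInterval (InitialEdge S s ε t) a b ∧
    Δ = convexHull ℝ {s.left, t.pt a, t.pt b} ∧ r ∈ Ioo a b ∧ p ∈ openSegment ℝ s.left (t.pt r)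

/-- `Δ` is a sweep triangle that contains `p` in its interior, and `p` is on the active edge when
the sweep is at the parameter `r`. -/
def SweepAt (S : Finset Seg) (s : Seg) (ε : ℝ) (Δ : Set Plane) (p : Plane) (r : ℝ) : Prop :=
  ∃ f ∈ S, ∃ q u : Plane, f.HasEnds q u ∧ ∃ t ∈ S, ∃ a b : ℝ,
    IsMaxInterval (fun r => ActiveEdge S s ε q u t (s.pt r)) a b ∧ r ∈ Ioo a b ∧
    (∃ α β : ℝ, 0 < α ∧ 0 < β ∧
      q + α • (q - s.pt a) ∈ t.carrier ∧ q + β • (q - s.pt b) ∈ t.carrier ∧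
      Δ = convexHull ℝ {q, q + α • (q - s.pt a), q + β • (q - s.pt b)}) ∧
    cross t.dir (q - t.left) ≠ 0 ∧
    ∃ c k τ : ℝ, 0 < k ∧ k < c ∧ 0 < τ ∧ τ < 1 ∧ q + c • (q - s.pt r) = t.pt τ ∧
      Visible S q (q + c • (q - s.pt r)) ∧ p = q + k • (q - s.pt r)

lemma initialAt_of_mem_interior {s : Seg} {ε : ℝ} {Δ : Set Plane}
    (hΔ : Δ ∈ initialTriangles S s ε) {p : Plane} (hp : p ∈ interior Δ) :
    s.OnSide ε p ∧ InitialAt S s ε Δ p := by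
  obtain ⟨t, ht, a, b, hab, rfl⟩ := hΔ
  obtain ⟨y, z, hy, hz, hyz, rfl⟩ := weights_of_mem_interior hp
  have hlt := hab.2.1
  have hr : (y * a + z * b) / (y + z) ∈ Ioo a b := by
    constructor
    · rw [lt_div_iff₀ (by positivity)]; nlinarith
    · rw [div_lt_iff₀ (by positivity)]; nlinarith
  set r := (y * a + z * b) / (y + z) with hrdef
  have hp' : s.left + y • (t.pt a - s.left) + z • (t.pt b - s.left) =
      s.left + (y + z) • (t.pt r - s.left) := by
    have hr' : (y + z) * r = y * a + z * b := by rw [hrdef]; field_simp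
    have : (y + z) • (t.pt r - s.left) = (y + z) • (t.left - s.left) + ((y + z) * r) • t.dir := by
      rw [Seg.pt_eq]; module
    rw [this, hr', Seg.pt_eq, Seg.pt_eq]; module
  have hP := hab.2.2.2.1 r hr
  rw [hp']
  refine ⟨?_, t, ht, a, b, r, hab, rfl, hr, mem_openSegment_iff.2 ⟨y + z, by positivity, hyz, rfl⟩⟩
  rw [onSide_iff, add_sub_cancel_left, cross_smul_right]
  have h1 : 0 < ε * cross s.dir (t.pt r - s.left) := hP.1
  have : 0 < (y + z) * (ε * cross s.dir (t.pt r - s.left)) := mul_pos (by positivity) h1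
  linarith

lemma sweepAt_of_mem_interior {s : Seg} {ε : ℝ} {Δ : Set Plane}
    (hΔ : Δ ∈ sweepTriangles S s ε) {p : Plane} (hp : p ∈ interior Δ) :
    s.OnSide ε p ∧ ∃ r, SweepAt S s ε Δ p r := by
  obtain ⟨f, hf, q, u, hqu, t, ht, a, b, hab, α, β, hα, hβ, hA, hB, rfl⟩ := hΔ
  obtain ⟨y, z, hy, hz, hyz, rfl⟩ := weights_of_mem_interior hp
  have hlt := hab.2.1
  have hyα : 0 < y * α := by positivity
  have hzβ : 0 < z * β := by positivity
  -- The line through `p` and `q` meets `s` at the mean of `a` and `b` with weights `y * α` and `z *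
  -- β`.
  have hr : (y * α * a + z * β * b) / (y * α + z * β) ∈ Ioo a b := by
    constructor
    · rw [lt_div_iff₀ (by positivity)]; nlinarith
    · rw [div_lt_iff₀ (by positivity)]; nlinarith
  set k := y * α + z * β with hk
  set r := (y * α * a + z * β * b) / k with hrdef
  have hk0 : 0 < k := by positivity
  have hyz0 : 0 < y + z := by positivity
  have hkr : k * r = y * α * a + z * β * b := by rw [hrdef]; field_simp
  have hsum : y • (q + α • (q - s.pt a) - q) + z • (q + β • (q - s.pt b) - q) =
      k • (q - s.pt r) := by
    have : k • (q - s.pt r) = k • (q - s.left) - (k * r) • s.dir := by rw [Seg.pt_eq]; module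
    rw [this, hkr, hk, Seg.pt_eq, Seg.pt_eq]; module
  have hPr := hab.2.2.2.1 r hr
  have hq : s.OnSide ε q := hPr.1
  have hqt : cross t.dir (q - t.left) ≠ 0 := off_line_of_two_hits hq.cross_ne hlt.ne hα hβ hA hB
  obtain ⟨τ₁, h10, h11, hτ₁⟩ := Seg.mem_carrier.1 hA
  obtain ⟨τ₂, h20, h21, hτ₂⟩ := Seg.mem_carrier.1 hB
  -- The far corners differ, so the hit behind `p` is a relative interior point of `t`. This later
  -- identifies `t`, since only endpoints can be shared.
  have hττ : τ₁ ≠ τ₂ := by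
    rintro rfl
    have hAB : α • (q - s.pt a) = β • (q - s.pt b) := add_left_cancel (hτ₁.trans hτ₂.symm)
    have h1 := congrArg (cross s.dir) hAB
    rw [cross_smul_right, cross_smul_right, cross_off_pt, cross_off_pt, cross_self, mul_zero,
      mul_zero, sub_zero] at h1
    have h2 : α = β := mul_right_cancel₀ hq.cross_ne h1
    subst h2
    have h3 := smul_right_injective Plane hα.ne' hAB
    exact hlt.ne (s.pt_injective (sub_right_injective h3))
  have hw : q + (k / (y + z)) • (q - s.pt r) = t.pt ((y * τ₁ + z * τ₂) / (y + z)) := by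
    have h1 : (k / (y + z)) • (q - s.pt r) = (y + z)⁻¹ • (k • (q - s.pt r)) := by
      rw [smul_smul]; congr 1; ring
    rw [h1, ← hsum, hτ₁, hτ₂]
    simp only [Seg.pt_eq]
    ext <;> simp only [Prod.fst_add, Prod.smul_fst, Prod.fst_sub, Prod.snd_add, Prod.smul_snd,
      Prod.snd_sub, smul_eq_mul] <;> field_simp <;> ring
  have hτ : 0 < (y * τ₁ + z * τ₂) / (y + z) ∧ (y * τ₁ + z * τ₂) / (y + z) < 1 := by
    rw [lt_div_iff₀ hyz0, div_lt_iff₀ hyz0]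
    rcases lt_or_gt_of_ne hττ with h | h
    · constructor
      · nlinarith [mul_nonneg hy.le h10, mul_pos hz (h10.trans_lt h)]
      · nlinarith [mul_pos hy (sub_pos.2 (h.trans_le h21)), mul_nonneg hz.le (sub_nonneg.2 h21)]
    · constructor
      · nlinarith [mul_nonneg hz.le h20, mul_pos hy (h20.trans_lt h)]
      · nlinarith [mul_pos hz (sub_pos.2 (h.trans_le h11)), mul_nonneg hy.le (sub_nonneg.2 h11)]
  have hkc : k < k / (y + z) := by
    rw [lt_div_iff₀ hyz0]; nlinarith
  obtain ⟨-, -, -, c, hc, hcw, hcv⟩ := hPr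
  obtain rfl : c = k / (y + z) :=
    hit_unique hqt hcw (hw ▸ t.pt_mem hτ.1.le hτ.2.le)
  rw [add_assoc, hsum]
  refine ⟨?_, r, f, hf, q, u, hqu, t, ht, a, b, hab, hr, ⟨α, β, hα, hβ, hA, hB, rfl⟩, hqt,
    k / (y + z), k, _, hk0, hkc, hτ.1, hτ.2, hw, hcv, rfl⟩
  rw [onSide_iff] at hq ⊢
  rw [add_sub_right_comm, cross_add_right, cross_smul_right, cross_off_pt, cross_self, mul_zero,
    sub_zero]
  have := mul_pos hk0 hq
  linarith

lemma InitialAt.notMem {s : Seg} {ε : ℝ} {Δ : Set Plane} {p : Plane} (h : InitialAt S s ε Δ p)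
    {g : Seg} (hg : g ∈ S) : p ∉ g.carrier := by
  obtain ⟨t, ht, a, b, r, hab, -, hr, hp⟩ := h
  have hP := hab.2.2.2.1 r hr
  refine hP.2.notMem ?_ hp hg
  intro h
  have := hP.1.cross_ne
  rw [← h, sub_self] at this
  exact this (cross_zero_right _)

lemma ray_ne {s : Seg} {ε : ℝ} {q : Plane} (hq : s.OnSide ε q) {c r : ℝ} (hc : 0 < c) :
    q ≠ q + c • (q - s.pt r) := by
  intro h
  have h1 : c • (q - s.pt r) = 0 := by simpa using h
  have h2 := (smul_eq_zero.1 h1).resolve_left hc.ne'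
  have h3 := hq.cross_ne
  rw [sub_eq_zero.1 h2] at h3
  exact h3 (s.cross_dir_pt r)

lemma SweepAt.notMem {s : Seg} {ε : ℝ} {Δ : Set Plane} {p : Plane} {r : ℝ}
    (h : SweepAt S s ε Δ p r) {g : Seg} (hg : g ∈ S) : p ∉ g.carrier := by
  obtain ⟨f, hf, q, u, hqu, t, ht, a, b, hab, hr, -, hqt, c, k, τ, hk, hkc, -, -, hw, hv, rfl⟩ := h
  have hc : 0 < c := hk.trans hkc
  refine hv.notMem (ray_ne (hab.2.2.2.1 r hr).1 hc) (mem_openSegment_iff.2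
    ⟨k / c, by positivity, (div_lt_one hc).2 hkc, ?_⟩) hg
  rw [add_sub_cancel_left, smul_smul, div_mul_cancel₀ _ hc.ne']

lemma InitialAt.visible {s : Seg} {ε : ℝ} {Δ : Set Plane} {p : Plane} (h : InitialAt S s ε Δ p) :
    Visible S p (s.pt 0) := by
  obtain ⟨t, ht, a, b, r, hab, -, hr, hp⟩ := h
  have hP := hab.2.2.2.1 r hr
  have hne : s.left ≠ t.pt r := by
    intro h
    have := hP.1.cross_ne
    rw [← h, sub_self] at this
    exact this (cross_zero_right _)
  refine Visible.symm (Or.inr fun g hg => Set.disjoint_left.2 fun z hz => ?_)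
  refine hP.2.notMem hne ?_ hg
  rw [Seg.pt_zero] at hz
  obtain ⟨l, hl0, hl1, rfl⟩ := mem_openSegment_iff.1 hp
  obtain ⟨m, hm0, hm1, rfl⟩ := mem_openSegment_iff.1 hz
  exact mem_openSegment_iff.2 ⟨m * l, by positivity, by nlinarith, by module⟩

/-- The starting point of the active edge blocks the view along it. -/
lemma SweepAt.not_visible {s : Seg} {ε : ℝ} {Δ : Set Plane} {p : Plane} {r : ℝ}
    (h : SweepAt S s ε Δ p r) : ¬ Visible S p (s.pt r) := by
  obtain ⟨f, hf, q, u, hqu, t, ht, a, b, hab, hr, -, hqt, c, k, τ, hk, hkc, -, -, hw, hv, rfl⟩ := h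
  have hq := (hab.2.2.2.1 r hr).1
  rw [visible_comm]
  refine fun hvis => hvis.notMem ?_ (z := q) ?_ hf hqu.mem_left
  · intro h
    have h1 : (1 + k) • (q - s.pt r) = 0 := by
      have : (1 + k) • (q - s.pt r) = q + k • (q - s.pt r) - s.pt r := by module
      rw [this, ← h, sub_self]
    have h2 := (smul_eq_zero.1 h1).resolve_left (by positivity)
    have h3 := hq.cross_ne
    rw [sub_eq_zero.1 h2] at h3
    exact h3 (s.cross_dir_pt r)
  · refine mem_openSegment_iff.2 ⟨1 / (1 + k), by positivity, ?_, ?_⟩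
    · rw [div_lt_one (by positivity)]; linarith
    · have : q + k • (q - s.pt r) - s.pt r = (1 + k) • (q - s.pt r) := by module
      rw [this, smul_smul, one_div, inv_mul_cancel₀ (by positivity)]
      module

/-- To the right of the active edge, `p` sees the segment that is swept over. -/
lemma SweepAt.eventually_visible (F : Frame S R) {s : Seg} (hs : s ∈ S) {ε : ℝ} {Δ : Set Plane}
    {p : Plane} (hp : p ∈ interior R) {r : ℝ} (h : SweepAt S s ε Δ p r) (hside : s.OnSide ε p) :
    ∀ᶠ r' in 𝓝[>] r, r' ≤ 1 → Visible S p (s.pt r') := by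
  have hpS : ∀ g ∈ S, p ∉ g.carrier := fun g hg => h.notMem hg
  obtain ⟨f, hf, q, u, hqu, t, ht, a, b, hab, hr, -, hqt, c, k, τ, hk, hkc, -, -, hw, hv, hpq⟩ := h
  obtain ⟨hq, hxq, hu, -⟩ := hab.2.2.2.1 r hr
  have hr0 : 0 < r := hab.1.trans_lt hr.1
  have hr1 : r < 1 := hr.2.trans_le hab.2.2.1
  have hc : 0 < c := hk.trans hkc
  have hx := s.pt_mem hr0.le hr1.le
  have hqx : s.pt r ≠ q := by
    rintro rfl; exact hq.cross_ne (s.cross_dir_pt r)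
  have hqR : q ∈ interior R := by
    refine F.openSegment_subset hp (F.subset s hs hx) ?_
    rw [openSegment_symm, mem_openSegment_iff]
    refine ⟨1 / (1 + k), by positivity, ?_, ?_⟩
    · rw [div_lt_one (by positivity)]; linarith
    · have : p - s.pt r = (1 + k) • (q - s.pt r) := by rw [hpq]; module
      rw [this, smul_smul, one_div, inv_mul_cancel₀ (by positivity)]
      module
  have key : ∀ g ∈ S, ∀ᶠ r' in 𝓝[>] r, r' ≤ 1 →
      Disjoint (openSegment ℝ p (s.pt r')) g.carrier := by
    intro g hg
    by_cases hgs : g = s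
    · subst hgs
      exact Eventually.of_forall fun r _ => disjoint_openSegment_self hside.cross_ne r
    -- The segment `f` lies on one closed side of the ray through `q` by `hu`, while the open sight
    -- lines to `s.pt r'` with `r < r'` lie strictly on the other side.
    by_cases hgf : g = f
    · subst hgf
      filter_upwards [self_mem_nhdsWithin] with r' hr' _
      have hr' : r < r' := hr'
      refine Set.disjoint_left.2 fun z hz hzf => ?_
      rw [hqu.carrier_eq, segment_eq_image'] at hzf
      obtain ⟨m, ⟨hm0, -⟩, rfl⟩ := hzf
      obtain ⟨l, hl0, hl1, hl⟩ := mem_openSegment_iff.1 hz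
      simp only at hl
      have e1 : m • (u - q) = ((1 - l) * k - l) • (q - s.pt r) + (l * (r' - r)) • s.dir := by
        have : m • (u - q) = (q + m • (u - q)) - q := by module
        rw [this, hl, hpq, Seg.pt_eq, Seg.pt_eq]; module
      have e2 := congrArg (cross (q - s.pt r)) e1
      rw [cross_smul_right, cross_add_right, cross_smul_right, cross_smul_right, cross_self,
        mul_zero, zero_add, cross_swap _ s.dir, cross_off_pt, cross_self, mul_zero, sub_zero] at e2
      have h1 : 0 ≤ m * (ε * cross (q - s.pt r) (u - q)) := mul_nonneg hm0 hu.le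
      have h2 : 0 < l * (r' - r) * (ε * cross s.dir (q - s.left)) :=
        mul_pos (mul_pos hl0 (by linarith)) hq
      have h3 : m * (ε * cross (q - s.pt r) (u - q)) =
          -(l * (r' - r) * (ε * cross s.dir (q - s.left))) := by
        linear_combination ε * e2
      linarith
    rcases F.inside_or_disjoint g hg with hin | hdis
    · have hd : Disjoint (segment ℝ p (s.pt r)) g.carrier := by
        rw [Set.disjoint_left]
        intro z hz hzg
        rw [segment_symm, segment_eq_image'] at hz
        obtain ⟨m, ⟨hm0, hm1⟩, rfl⟩ := hz
        have e : s.pt r + m • (p - s.pt r) = s.pt r + (m * (1 + k)) • (q - s.pt r) := by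
          rw [hpq]; module
        simp only [e] at hzg
        rcases eq_or_lt_of_le hm0 with rfl | hm0
        · rw [zero_mul, zero_smul, add_zero] at hzg
          exact (F.meet g hg s hs hgs _ hzg hx).1 (hin hzg)
        have hmk : 0 < m * (1 + k) := by positivity
        -- Between `s.pt r` and `q` the sight line is free; at `q`, an inner point, `f` is the only
        -- element; beyond `q` the active edge is free.
        rcases lt_trichotomy (m * (1 + k)) 1 with h | h | h
        · exact hxq.notMem hqx (mem_openSegment_iff.2 ⟨_, hmk, h, rfl⟩) hg hzg
        · rw [h, one_smul, add_sub_cancel] at hzg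
          exact (F.meet g hg f hf hgf _ hzg hqu.mem_left).1 hqR
        · refine hv.notMem (ray_ne hq hc) (mem_openSegment_iff.2
            ⟨(m * (1 + k) - 1) / c, div_pos (by linarith) hc, ?_, ?_⟩) hg hzg
          · rw [div_lt_one hc]; nlinarith
          · rw [add_sub_cancel_left, smul_smul, div_mul_cancel₀ _ hc.ne']
            module
      have := s.continuous_pt.continuousAt.eventually
        (eventually_disjoint_segment g.isClosed_carrier hd)
      exact nhdsWithin_le_nhds
        (this.mono fun r hr _ => hr.mono_left (openSegment_subset_segment _ _ _))
    · filter_upwards [self_mem_nhdsWithin] with r' hr' h1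
      exact (hdis.mono_right (F.openSegment_subset hp
        (F.subset s hs (s.pt_mem (hr0.trans hr').le h1)))).symm
  filter_upwards [(eventually_all_finset S).2 key] with r hr h1
  exact Or.inr fun f hf => hr f hf h1

/-- The points just to the right of `r` are visible, and the maximal interval containing them cannot
pass `r`, where the view is blocked. -/
lemma SweepAt.exists_piece (F : Frame S R) {s : Seg} (hs : s ∈ S) {ε : ℝ} {Δ : Set Plane}
    {p : Plane} (hp : p ∈ interior R) {r : ℝ} (h : SweepAt S s ε Δ p r) (hside : s.OnSide ε p) :
    ∃ b, IsMaxInterval (fun r => Visible S p (s.pt r)) r b := by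
  have hev := h.eventually_visible F hs hp hside
  have hnv := h.not_visible
  obtain ⟨f, hf, q, u, hqu, t, ht, a, b, hab, hr, -⟩ := h
  have hr0 : 0 < r := hab.1.trans_lt hr.1
  have hr1 : r < 1 := hr.2.trans_le hab.2.2.1
  obtain ⟨d, hd, hd'⟩ := (mem_nhdsGT_iff_exists_Ioo_subset' hr1).1 hev
  obtain ⟨a', b', hab', ha', hb'⟩ := IsMaxInterval.exists_of_forall
    (P := fun r => Visible S p (s.pt r)) hr0.le (lt_min hd hr1) (min_le_right d 1)
    (fun x hx => hd' ⟨hx.1, hx.2.trans_le (min_le_left _ _)⟩ (hx.2.trans_le (min_le_right _ _)).le)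
  rcases eq_or_lt_of_le ha' with rfl | hlt
  · exact ⟨b', hab'⟩
  · exact absurd (hab'.2.2.2.1 r ⟨hlt, (lt_min hd hr1).trans_le hb'⟩) hnv

lemma InitialAt.exists_piece (F : Frame S R) {s : Seg} (hs : s ∈ S) {ε : ℝ} {Δ : Set Plane}
    {p : Plane} (hp : p ∈ interior R) (h : InitialAt S s ε Δ p) (hside : s.OnSide ε p) :
    ∃ b, IsMaxInterval (fun r => Visible S p (s.pt r)) 0 b := by
  obtain ⟨c, d, ⟨hc, hd⟩, hcd⟩ := mem_nhds_iff_exists_Ioo_subset.1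
    (F.eventually_visible hp (fun g hg => h.notMem hg) hs hside.cross_ne le_rfl zero_le_one
      h.visible)
  obtain ⟨a', b', hab', ha', hb'⟩ := IsMaxInterval.exists_of_forall
    (P := fun r => Visible S p (s.pt r)) le_rfl (lt_min hd one_pos) (min_le_right d 1)
    (fun x hx => hcd ⟨hc.trans hx.1, hx.2.trans_le (min_le_left _ _)⟩ hx.1.le
      (hx.2.trans_le (min_le_right _ _)).le)
  obtain rfl : a' = 0 := le_antisymm ha' hab'.1
  exact ⟨b', hab'⟩

/-! ### A visible part determines its triangle -/

lemma eq_of_first_hits {o v : Plane} {c c' : ℝ} (hv : v ≠ 0) (hc : 0 < c) (hc' : 0 < c')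
    (h : Visible S o (o + c • v)) (h' : Visible S o (o + c' • v))
    (ht : ∃ t ∈ S, o + c • v ∈ t.carrier) (ht' : ∃ t ∈ S, o + c' • v ∈ t.carrier) : c = c' := by
  have key : ∀ {c c' : ℝ}, 0 < c → 0 < c' → Visible S o (o + c' • v) →
      (∃ t ∈ S, o + c • v ∈ t.carrier) → c' ≤ c := by
    rintro c c' hc hc' h' ⟨t, ht, hct⟩
    by_contra hlt
    rw [not_le] at hlt
    refine h'.notMem ?_ (z := o + c • v) ?_ ht hct
    · intro h
      have : c' • v = 0 := by simpa using h
      exact (smul_ne_zero hc'.ne' hv) this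
    · refine mem_openSegment_iff.2 ⟨c / c', by positivity, (div_lt_one hc').2 hlt, ?_⟩
      rw [add_sub_cancel_left, smul_smul, div_mul_cancel₀ _ hc'.ne']
  exact le_antisymm (key hc' hc h ht') (key hc hc' h' ht)

lemma Frame.eq_of_mem_inner (F : Frame S R) {t t' : Seg} (ht : t ∈ S) (ht' : t' ∈ S) {r : ℝ}
    (h0 : 0 < r) (h1 : r < 1) (h : t.pt r ∈ t'.carrier) : t = t' := by
  by_contra hne
  rcases (F.meet t ht t' ht' hne _ (t.pt_mem h0.le h1.le) h).2 with h | h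
  · rw [← t.pt_zero] at h
    exact h0.ne' (t.pt_injective h)
  · rw [← t.pt_one] at h
    exact h1.ne (t.pt_injective h)

/-- The first hit behind `p` on the ray from the left endpoint is a relative interior point of the
far segment. It determines that segment, the parameter, and the maximal interval around it. -/
lemma InitialAt.unique (F : Frame S R) {s : Seg} {ε : ℝ} {Δ Δ' : Set Plane} {p : Plane}
    (h : InitialAt S s ε Δ p) (h' : InitialAt S s ε Δ' p) : Δ = Δ' := by
  obtain ⟨t, ht, a, b, r, hab, rfl, hr, hp⟩ := h
  obtain ⟨t', ht', a', b', r', hab', rfl, hr', hp'⟩ := h'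
  have hP := hab.2.2.2.1 r hr
  have hP' := hab'.2.2.2.1 r' hr'
  have hr0 : 0 < r := hab.1.trans_lt hr.1
  have hr1 : r < 1 := hr.2.trans_le hab.2.2.1
  have hr0' : 0 < r' := hab'.1.trans_lt hr'.1
  have hr1' : r' < 1 := hr'.2.trans_le hab'.2.2.1
  obtain ⟨l, hl0, hl1, hl⟩ := mem_openSegment_iff.1 hp
  obtain ⟨m, hm0, hm1, hm⟩ := mem_openSegment_iff.1 hp'
  have e : s.left + l⁻¹ • (p - s.left) = t.pt r := by
    rw [hl, add_sub_cancel_left, inv_smul_smul₀ hl0.ne']; module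
  have e' : s.left + m⁻¹ • (p - s.left) = t'.pt r' := by
    rw [hm, add_sub_cancel_left, inv_smul_smul₀ hm0.ne']; module
  have hne : p - s.left ≠ 0 := by
    intro h
    have h1 := hP.1.cross_ne
    rw [h, smul_zero, add_zero] at e
    rw [← e, sub_self] at h1
    exact h1 (cross_zero_right _)
  have hlm : l⁻¹ = m⁻¹ := eq_of_first_hits (S := S) hne (by positivity) (by positivity)
    (e ▸ hP.2) (e' ▸ hP'.2) ⟨t, ht, e ▸ t.pt_mem hr0.le hr1.le⟩
    ⟨t', ht', e' ▸ t'.pt_mem hr0'.le hr1'.le⟩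
  have hw : t.pt r = t'.pt r' := by rw [← e, ← e', hlm]
  obtain rfl := F.eq_of_mem_inner ht ht' hr0 hr1 (hw ▸ t'.pt_mem hr0'.le hr1'.le)
  obtain rfl := t.pt_injective hw
  obtain ⟨rfl, rfl⟩ := hab.eq_of_mem hab' hr hr'
  rfl

/-- From `s.pt r` towards `p` the first hit is `q`; being an inner point, `q` belongs to one segment
only, which fixes `f` and `u`. The first hit beyond `q` then fixes `t`, and `r` fixes the maximal
interval. -/
lemma SweepAt.unique (F : Frame S R) {s : Seg} (hs : s ∈ S) {ε : ℝ} {Δ Δ' : Set Plane}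
    {p : Plane} (hpR : p ∈ interior R) {r : ℝ} (h : SweepAt S s ε Δ p r)
    (h' : SweepAt S s ε Δ' p r) : Δ = Δ' := by
  obtain ⟨f, hf, q, u, hqu, t, ht, a, b, hab, hr, ⟨α, β, hα, hβ, hA, hB, rfl⟩, hqt, c, k, τ, hk, hkc,
    hτ0, hτ1, hw, hv, hpq⟩ := h
  obtain ⟨f', hf', q', u', hqu', t', ht', a', b', hab', hr', ⟨α', β', hα', hβ', hA', hB', rfl⟩, -,
    c', k', τ', hk', hkc', hτ0', hτ1', hw', hv', hpq'⟩ := h'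
  have hP := hab.2.2.2.1 r hr
  have hP' := hab'.2.2.2.1 r hr'
  have hr0 : 0 < r := hab.1.trans_lt hr.1
  have hr1 : r < 1 := hr.2.trans_le hab.2.2.1
  set x := s.pt r with hx
  have hqx : q - x ≠ 0 := by
    intro h
    have h3 := hP.1.cross_ne
    rw [sub_eq_zero.1 h] at h3
    exact h3 (s.cross_dir_pt r)
  have hpx : p - x = (1 + k) • (q - x) := by rw [hpq]; module
  have hpx' : p - x = (1 + k') • (q' - x) := by rw [hpq']; module
  have hpx0 : p - x ≠ 0 := by rw [hpx]; exact smul_ne_zero (by positivity) hqx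
  have hq : x + (1 + k)⁻¹ • (p - x) = q := by
    rw [hpx, inv_smul_smul₀ (by positivity)]; module
  have hq' : x + (1 + k')⁻¹ • (p - x) = q' := by
    rw [hpx', inv_smul_smul₀ (by positivity)]; module
  have hkk : (1 + k)⁻¹ = (1 + k')⁻¹ := eq_of_first_hits (S := S) hpx0 (by positivity) (by positivity)
    (hq ▸ hP.2.1) (hq' ▸ hP'.2.1) ⟨f, hf, hq ▸ hqu.mem_left⟩ ⟨f', hf', hq' ▸ hqu'.mem_left⟩
  have hqq : q = q' := by rw [← hq, ← hq', hkk]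
  subst hqq
  have hqR : q ∈ interior R := by
    refine F.openSegment_subset hpR (F.subset s hs (s.pt_mem hr0.le hr1.le)) ?_
    rw [openSegment_symm, mem_openSegment_iff]
    exact ⟨_, by positivity, inv_lt_one_of_one_lt₀ (by linarith), hq.symm⟩
  have hff : f = f' := by
    by_contra hne
    exact (F.meet f hf f' hf' hne q hqu.mem_left hqu'.mem_left).1 hqR
  subst hff
  have huu : u = u' := by
    have hlr : f.left ≠ f.right := fun h => f.lt.ne (congrArg Prod.fst h)
    rcases hqu with ⟨h1, h2⟩ | ⟨h1, h2⟩ <;> rcases hqu' with ⟨h3, h4⟩ | ⟨h3, h4⟩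
    · rw [h2, h4]
    · exact absurd (h1.symm.trans h3) hlr
    · exact absurd (h3.symm.trans h1) hlr
    · rw [h2, h4]
  subst huu
  have hcc : c = c' := eq_of_first_hits (S := S) hqx (hk.trans hkc) (hk'.trans hkc') hv hv'
    ⟨t, ht, hw ▸ t.pt_mem hτ0.le hτ1.le⟩ ⟨t', ht', hw' ▸ t'.pt_mem hτ0'.le hτ1'.le⟩
  subst hcc
  obtain rfl := F.eq_of_mem_inner ht ht' hτ0 hτ1
    (by rw [← hw, hw']; exact t'.pt_mem hτ0'.le hτ1'.le)
  obtain ⟨rfl, rfl⟩ := hab.eq_of_mem hab' hr hr'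
  rw [hit_unique hqt hA hA', hit_unique hqt hB hB']

/-! ### Visible endpoints -/

/-- The visible part `(a, b)` of `s` begins, in counterclockwise order around `p`, in the direction
of `q`. -/
def StartsAt (p : Plane) (s : Seg) (a b : ℝ) (q : Plane) : Prop :=
  ∃ ε e e' : ℝ, s.OnSide ε p ∧ ((ε = 1 ∧ e = a ∧ e' = b) ∨ (ε = -1 ∧ e = b ∧ e' = a)) ∧
    ∃ m : ℝ, 0 < m ∧ s.pt e = p + m • (q - p)

/-- Behind the end of a visible part, there is a visible endpoint, or the end is an endpoint. -/
lemma exists_visible_end {p : Plane} (hpS : ∀ g ∈ S, p ∉ g.carrier) {s : Seg} (hs : s ∈ S)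
    {x d : Plane} (hx : Visible S p x → x = s.left ∨ x = s.right) {δ : ℝ} (hδ : 0 < δ)
    (hvis : ∀ ρ ∈ Ioo 0 δ, Visible S p (x + ρ • d)) (hd : cross d (p - x) ≠ 0) :
    ∃ q, (∃ f ∈ S, q = f.left ∨ q = f.right) ∧ Visible S p q ∧
      ∃ m : ℝ, 0 < m ∧ x = p + m • (q - p) := by
  by_cases hv : Visible S p x
  · exact ⟨x, ⟨s, hs, hx hv⟩, hv, 1, one_pos, by module⟩
  obtain ⟨hpx, g, hg, z, hz, hzg⟩ := not_visible_iff.1 hv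
  obtain ⟨l, hl0, hl1, rfl⟩ := mem_openSegment_iff.1 hz
  obtain ⟨c, hc, hcl, ⟨f, hf, hcf⟩, hcv⟩ := exists_first_hit S (o := p) (v := x - p) (c₁ := 0)
    (c₂ := l) le_rfl (fun c h1 h2 => absurd h1 (not_lt.2 h2.le))
    (by simpa using hpS) hl0.le ⟨g, hg, hzg⟩
  have hxp : x - p ≠ 0 := sub_ne_zero.2 hpx.symm
  set q := p + c • (x - p) with hq
  refine ⟨q, ⟨f, hf, ?_⟩, hcv, c⁻¹, by positivity, ?_⟩
  · have hqo : q ∈ openSegment ℝ p x := mem_openSegment_iff.2 ⟨c, hc, by linarith, rfl⟩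
    -- Here `f` is seen edge-on. It lies along the ray and contains nothing between `p` and `q`, so
    -- `q` is its nearest point and therefore an endpoint.
    by_cases hpf : cross f.dir (p - f.left) = 0
    · have hfree : ∀ m, 0 < m → m < c → p + m • (x - p) ∉ f.carrier := by
        intro m hm0 hmc
        refine hcv.notMem ?_ (mem_openSegment_iff.2 ⟨m / c, by positivity, (div_lt_one hc).2 hmc, ?_⟩)
          hf
        · intro h
          have : c • (x - p) = 0 := by simpa [hq] using h
          exact smul_ne_zero hc.ne' hxp this
        · rw [hq, add_sub_cancel_left, smul_smul, div_mul_cancel₀ _ hc.ne']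
      have hdir : cross f.dir (x - p) = 0 := by
        have h1 := Seg.cross_dir_of_mem hcf
        rw [hq, add_sub_right_comm, cross_add_right, hpf, zero_add, cross_smul_right] at h1
        exact (mul_eq_zero.1 h1).resolve_left hc.ne'
      have hx1 : (x - p).1 ≠ 0 := by
        intro h0
        apply hxp
        have : f.dir.1 * (x - p).2 = 0 := by
          simp only [cross] at hdir
          rw [h0, mul_zero, sub_zero] at hdir
          exact hdir
        exact Prod.ext h0 ((mul_eq_zero.1 this).resolve_left f.dir_fst_pos.ne')
      have hκ : f.dir = (f.dir.1 / (x - p).1) • (x - p) := by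
        ext
        · simp only [Prod.smul_fst, smul_eq_mul]; field_simp
        · simp only [Prod.smul_snd, smul_eq_mul]
          simp only [cross] at hdir
          field_simp
          linarith
      set κ := f.dir.1 / (x - p).1 with hκdef
      have hκ0 : κ ≠ 0 := div_ne_zero f.dir_fst_pos.ne' hx1
      obtain ⟨τ, h0, h1, hτ⟩ := Seg.mem_carrier.1 hcf
      have hpt : ∀ τ', f.pt τ' = p + (c + (τ' - τ) * κ) • (x - p) := by
        intro τ'
        have : f.pt τ' = f.pt τ + (τ' - τ) • f.dir := by rw [Seg.pt_eq, Seg.pt_eq]; module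
        rw [this, ← hτ, hκ, hq]; module
      have hge : ∀ τ', 0 ≤ τ' → τ' ≤ 1 → 0 ≤ (τ' - τ) * κ := by
        intro τ' h0' h1'
        by_contra hneg
        rw [not_le] at hneg
        set w := (τ' - τ) * κ with hwdef
        -- The step along `f` is shortened so that the point stays strictly between `p` and `q`.
        set m := min 1 (c / (2 * -w)) with hm
        have hm0 : 0 < m := lt_min one_pos (div_pos hc (by linarith))
        have hm1 : m ≤ 1 := min_le_left _ _
        have hm2 : m * (2 * -w) ≤ c := by
          have : m ≤ c / (2 * -w) := min_le_right _ _
          rwa [le_div_iff₀ (by linarith)] at this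
        have hmw : m * w < 0 := mul_neg_of_pos_of_neg hm0 hneg
        refine hfree (c + m * w) (by nlinarith) (by linarith) ?_
        have h2 := f.pt_mem (r := τ + m * (τ' - τ)) (by nlinarith) (by nlinarith)
        rw [hpt] at h2
        convert h2 using 3
        rw [hwdef]; ring
      have g0 := hge 0 le_rfl zero_le_one
      have g1 := hge 1 zero_le_one le_rfl
      rcases lt_or_gt_of_ne hκ0 with hk | hk
      · obtain rfl : τ = 1 := le_antisymm h1 (by nlinarith)
        exact Or.inr (hτ.trans f.pt_one)
      · obtain rfl : τ = 0 := le_antisymm (by nlinarith) h0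
        exact Or.inl (hτ.trans f.pt_zero)
    · obtain ⟨u, hu, -⟩ := hasEnds_of_blocker hδ hvis hd hf hqo hcf hpf
      exact hu.imp And.left And.left
  · rw [hq, add_sub_cancel_left, inv_smul_smul₀ hc.ne']; module

/-- Around a point above `s`, counterclockwise order runs along `s` from left to right; around a
point below, from right to left. So the first end is `a` or `b` according to `ε`. -/
lemma Frame.exists_startsAt (F : Frame S R) {p : Plane} (hp : p ∈ interior R)
    (hpS : ∀ g ∈ S, p ∉ g.carrier) {s : Seg} (hs : s ∈ S) {ε : ℝ} (hε : ε = 1 ∨ ε = -1)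
    (hside : s.OnSide ε p) {a b : ℝ} (hab : IsMaxInterval (fun r => Visible S p (s.pt r)) a b) :
    ∃ q, (∃ f ∈ S, q = f.left ∨ q = f.right) ∧ Visible S p q ∧ StartsAt p s a b q := by
  have hD : ∀ r, cross s.dir (p - s.pt r) ≠ 0 := fun r => by
    rw [cross_off_pt, cross_self, mul_zero, sub_zero]; exact hside.cross_ne
  have hba : 0 < b - a := sub_pos.2 hab.2.1
  rcases hε with rfl | rfl
  · obtain ⟨q, hq, hv, hm⟩ := exists_visible_end hpS hs (x := s.pt a) (d := s.dir) (δ := b - a)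
      (fun h => Or.inl (by rw [F.piece_left hp hpS hs hside.cross_ne hab h, Seg.pt_zero])) hba
      (by
        rintro ρ ⟨h0, h1⟩
        convert hab.2.2.2.1 (a + ρ) ⟨by linarith, by linarith⟩ using 1
        rw [Seg.pt_eq, Seg.pt_eq]; module) (hD a)
    exact ⟨q, hq, hv, 1, a, b, hside, Or.inl ⟨rfl, rfl, rfl⟩, hm⟩
  · obtain ⟨q, hq, hv, hm⟩ := exists_visible_end hpS hs (x := s.pt b) (d := (-1 : ℝ) • s.dir)
      (δ := b - a)
      (fun h => Or.inr (by rw [F.piece_right hp hpS hs hside.cross_ne hab h, Seg.pt_one])) hba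
      (by
        rintro ρ ⟨h0, h1⟩
        convert hab.2.2.2.1 (b - ρ) ⟨by linarith, by linarith⟩ using 1
        rw [Seg.pt_eq, Seg.pt_eq]; module)
      (by rw [cross_smul_left]; exact mul_ne_zero (by norm_num) (hD b))
    exact ⟨q, hq, hv, -1, b, a, hside, Or.inr ⟨rfl, rfl, rfl⟩, hm⟩

/-- Counterclockwise next to the direction of `q`, the segment is visible. -/
lemma StartsAt.eventually_hit {p q : Plane} {s : Seg} {a b : ℝ} (h : StartsAt p s a b q)
    (hab : IsMaxInterval (fun r => Visible S p (s.pt r)) a b) :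
    ∀ᶠ η in 𝓝[>] (0 : ℝ), ∃ c r : ℝ, 0 < c ∧ 0 < r ∧ r < 1 ∧
      p + c • (q - p + η • (-(q - p).2, (q - p).1)) = s.pt r ∧ Visible S p (s.pt r) := by
  obtain ⟨ε, e, e', hside, hee, m, hm, hx⟩ := h
  set v := q - p with hv
  set n : Plane := (-v.2, v.1) with hn
  -- By Cramer's rule, the ray in direction `v + η • n` meets the line of `s` at `e + θ * (e' - e)`
  -- with `θ = η * N * m / (E + η * G)`, at the multiple `m - θ * (G / N)` of that direction. The
  -- sign choice in `StartsAt` amounts to `0 < E`, so `θ` is small and positive for small `η > 0`.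
  set N := cross v n with hN
  set E := (e' - e) * cross v s.dir with hE
  set G := (e' - e) * cross n s.dir with hG
  have hlt := hab.2.1
  have hmE : m * cross v s.dir = cross s.dir (p - s.left) := by
    have h1 : m • v = (-1 : ℝ) • (p - s.pt e) := by rw [hx]; module
    rw [← cross_smul_left, h1, cross_smul_left, cross_swap, cross_off_pt, cross_self]
    ring
  have hside' : 0 < ε * cross s.dir (p - s.left) := hside
  have hE0 : 0 < E := by
    have h1 : 0 < m * E := by
      have : m * E = (e' - e) * cross s.dir (p - s.left) := by
        rw [hE]; linear_combination (e' - e) * hmE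
      rw [this]
      rcases hee with ⟨rfl, rfl, rfl⟩ | ⟨rfl, rfl, rfl⟩
      · nlinarith
      · nlinarith
    exact (mul_pos_iff_of_pos_left hm).1 h1
  have hN' : N = v.1 ^ 2 + v.2 ^ 2 := by simp only [hN, hn, cross]; ring
  have hN0 : 0 < N := by
    rw [hN']
    by_contra h
    have h1 : v.1 = 0 := by nlinarith [sq_nonneg v.1, sq_nonneg v.2]
    have h2 : v.2 = 0 := by nlinarith [sq_nonneg v.1, sq_nonneg v.2]
    rw [hE, cross, h1, h2] at hE0
    simp at hE0
  have hden : Tendsto (fun η : ℝ => E + η * G) (𝓝[>] 0) (𝓝 E) := by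
    have : Continuous fun η : ℝ => E + η * G := by fun_prop
    simpa using (this.tendsto 0).mono_left nhdsWithin_le_nhds
  have hθ : Tendsto (fun η : ℝ => η * (N * m) / (E + η * G)) (𝓝[>] 0) (𝓝 0) := by
    have h1 : Tendsto (fun η : ℝ => η * (N * m)) (𝓝[>] 0) (𝓝 0) := by
      have : Continuous fun η : ℝ => η * (N * m) := by fun_prop
      simpa using (this.tendsto 0).mono_left nhdsWithin_le_nhds
    have h2 := h1.div hden hE0.ne'
    rw [zero_div] at h2
    exact h2
  have hc : Tendsto (fun η : ℝ => m - η * (N * m) / (E + η * G) * (G / N)) (𝓝[>] 0) (𝓝 m) := by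
    simpa using (tendsto_const_nhds (x := m)).sub (hθ.mul_const (G / N))
  filter_upwards [hden.eventually (Ioi_mem_nhds hE0), hθ.eventually (Iio_mem_nhds one_pos),
    hc.eventually (Ioi_mem_nhds hm), self_mem_nhdsWithin] with η h1 h2 h3 h4
  set θ := η * (N * m) / (E + η * G) with hθdef
  have h1 : 0 < E + η * G := h1
  have h2 : θ < 1 := h2
  have h4 : 0 < η := h4
  have hθ0 : 0 < θ := by positivity
  have hr : e + θ * (e' - e) ∈ Ioo a b := by
    rcases hee with ⟨rfl, rfl, rfl⟩ | ⟨rfl, rfl, rfl⟩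
    · constructor <;> nlinarith
    · constructor <;> nlinarith
  refine ⟨m - θ * (G / N), e + θ * (e' - e), h3, hab.1.trans_lt hr.1, hr.2.trans_le hab.2.2.1, ?_,
    hab.2.2.2.1 _ hr⟩
  have hθE : θ * E = (m - θ * (G / N)) * η * N := by
    have : θ * (E + η * G) = η * (N * m) := by rw [hθdef, div_mul_cancel₀ _ h1.ne']
    field_simp
    linear_combination this
  have hw : (e' - e) • s.dir = (E / N) • n - (G / N) • v := by
    have h5 : N • ((e' - e) • s.dir) = E • n - G • v := by
      simp only [hE, hG, hN, cross]
      ext <;> simp only [Prod.smul_fst, Prod.fst_sub, Prod.smul_snd, Prod.snd_sub,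
        smul_eq_mul] <;> ring
    rw [← inv_smul_smul₀ hN0.ne' ((e' - e) • s.dir), h5]; module
  have hpt : s.pt (e + θ * (e' - e)) = p + m • v + θ • ((e' - e) • s.dir) := by
    rw [← hx, Seg.pt_eq, Seg.pt_eq]; module
  have hcη : (m - θ * (G / N)) * η = θ * (E / N) := by
    rw [← mul_div_assoc θ E N, hθE]; field_simp
  rw [hpt, hw]
  have : p + (m - θ * (G / N)) • (v + η • n) =
      p + (m - θ * (G / N)) • v + ((m - θ * (G / N)) * η) • n := by module
  rw [this, hcη]
  module

/-- At most one visible part starts in a given direction. -/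
lemma StartsAt.unique (F : Frame S R) {p q : Plane} {s s' : Seg} (hs : s ∈ S) (hs' : s' ∈ S)
    {a b a' b' : ℝ} (h : StartsAt p s a b q) (h' : StartsAt p s' a' b' q)
    (hab : IsMaxInterval (fun r => Visible S p (s.pt r)) a b)
    (hab' : IsMaxInterval (fun r => Visible S p (s'.pt r)) a' b') : s = s' ∧ a = a' := by
  -- For a small rotation `η` both segments are the first hit in the same direction, at relative
  -- interior points.
  have hss : s = s' := by
    obtain ⟨η, ⟨c, r, hc, hr0, hr1, hr, hv⟩, c', r', hc', hr0', hr1', hr', hv'⟩ :=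
      ((h.eventually_hit hab).and (h'.eventually_hit hab')).exists
    set w := q - p + η • ((-(q - p).2, (q - p).1) : Plane) with hw
    have hw0 : w ≠ 0 := by
      rintro h0
      rw [h0, smul_zero, add_zero] at hr
      obtain ⟨ε, -, -, hside, -⟩ := h
      apply hside.cross_ne
      rw [hr, Seg.cross_dir_pt]
    have hcc : c = c' := eq_of_first_hits (S := S) hw0 hc hc' (hr ▸ hv) (hr' ▸ hv')
      ⟨s, hs, hr ▸ s.pt_mem hr0.le hr1.le⟩ ⟨s', hs', hr' ▸ s'.pt_mem hr0'.le hr1'.le⟩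
    subst hcc
    refine F.eq_of_mem_inner hs hs' hr0 hr1 ?_
    rw [← hr, hr']
    exact s'.pt_mem hr0'.le hr1'.le
  subst hss
  refine ⟨rfl, ?_⟩
  obtain ⟨ε, e, d, hside, hee, m, hm, hx⟩ := h
  obtain ⟨ε', e', d', hside', hee', m', hm', hx'⟩ := h'
  have he : 0 ≤ e ∧ e ≤ 1 := by
    have h1 := hab.1
    have h2 := hab.2.1
    have h3 := hab.2.2.1
    rcases hee with ⟨-, rfl, -⟩ | ⟨-, rfl, -⟩ <;> constructor <;> linarith
  have he' : 0 ≤ e' ∧ e' ≤ 1 := by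
    have h1 := hab'.1
    have h2 := hab'.2.1
    have h3 := hab'.2.2.1
    rcases hee' with ⟨-, rfl, -⟩ | ⟨-, rfl, -⟩ <;> constructor <;> linarith
  have hmm : m = m' := hit_unique hside.cross_ne (hx ▸ s.pt_mem he.1 he.2)
    (hx' ▸ s.pt_mem he'.1 he'.2)
  have hee0 : e = e' := s.pt_injective (by rw [hx, hx', hmm])
  rw [onSide_iff] at hside hside'
  rcases hee with ⟨rfl, h1, -⟩ | ⟨rfl, h1, -⟩ <;> rcases hee' with ⟨rfl, h2, -⟩ | ⟨rfl, h2, -⟩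
  · linarith
  · linarith
  · linarith
  -- Seen from below, it is the right ends that agree; the two maximal intervals overlap next to
  -- that end and hence coincide.
  · have hbb : b = b' := by linarith
    obtain ⟨r, hr⟩ := exists_between (max_lt hab.2.1 (hbb ▸ hab'.2.1))
    exact (hab.eq_of_mem hab' ⟨(le_max_left _ _).trans_lt hr.1, hr.2⟩
      ⟨(le_max_right _ _).trans_lt hr.1, hbb ▸ hr.2⟩).1

/-! ### Rectangles -/

/-- The parameters `i`, `j` of `x`, `y` in `s` lie in `[0, 1]` and have both 0 and 1 between them,
so they are 0 and 1 in some order. -/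
lemma Seg.ends_of_carrier_eq {s : Seg} {x y : Plane} (h : s.carrier = segment ℝ x y) :
    (s.left = x ∧ s.right = y) ∨ (s.left = y ∧ s.right = x) := by
  have hpar : ∀ z ∈ segment ℝ x y, ∃ l : ℝ, 0 ≤ l ∧ l ≤ 1 ∧ z = x + l • (y - x) := by
    intro z hz
    rw [segment_eq_image'] at hz
    obtain ⟨l, hl, rfl⟩ := hz
    exact ⟨l, hl.1, hl.2, rfl⟩
  obtain ⟨l, hl0, hl1, hl⟩ := hpar _ (h ▸ s.left_mem)
  obtain ⟨m, hm0, hm1, hm⟩ := hpar _ (h ▸ s.right_mem)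
  obtain ⟨i, hi0, hi1, hi⟩ := mem_carrier.1 (h ▸ left_mem_segment ℝ x y : x ∈ s.carrier)
  obtain ⟨j, hj0, hj1, hj⟩ := mem_carrier.1 (h ▸ right_mem_segment ℝ x y : y ∈ s.carrier)
  have hd := s.dir_fst_pos
  have hi' := congrArg Prod.fst hi
  have hj' := congrArg Prod.fst hj
  have hl' := congrArg Prod.fst hl
  have hm' := congrArg Prod.fst hm
  simp only [pt_eq, Prod.fst_add, Prod.smul_fst, Prod.fst_sub, smul_eq_mul] at hi' hj' hl' hm'
  have hr' : s.right.1 = s.left.1 + s.dir.1 := by simp [dir]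
  have e1 : i + l * (j - i) = 0 := by
    have : (i + l * (j - i)) * s.dir.1 = 0 := by
      rw [hi', hj'] at hl'; linear_combination -hl'
    exact (mul_eq_zero.1 this).resolve_right hd.ne'
  have e2 : i + m * (j - i) = 1 := by
    have : (i + m * (j - i) - 1) * s.dir.1 = 0 := by
      rw [hi', hj', hr'] at hm'; linear_combination -hm'
    linarith [(mul_eq_zero.1 this).resolve_right hd.ne']
  rcases le_total i j with hij | hij
  · have hi00 : i = 0 := le_antisymm (by nlinarith [mul_nonneg hl0 (sub_nonneg.2 hij)]) hi0
    have hj00 : j = 1 := by nlinarith [mul_nonneg (sub_nonneg.2 hm1) (sub_nonneg.2 hij)]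
    left
    rw [hi, hj, hi00, hj00, pt_zero, pt_one]; exact ⟨rfl, rfl⟩
  · have hj00 : j = 0 := le_antisymm (by nlinarith [mul_nonneg (sub_nonneg.2 hl1) (sub_nonneg.2 hij)]) hj0
    have hi00 : i = 1 := by nlinarith [mul_nonneg hm0 (sub_nonneg.2 hij)]
    right
    rw [hi, hj, hi00, hj00, pt_zero, pt_one]; exact ⟨rfl, rfl⟩

lemma Seg.carrier_injective : Function.Injective Seg.carrier := by
  intro s t h
  have hne : ∀ s t : Seg, s.left = t.left → s.right = t.right → s = t := by
    rintro ⟨a, b, _⟩ ⟨c, d, _⟩ h1 h2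
    simp only at h1 h2
    subst h1 h2
    rfl
  rcases Seg.ends_of_carrier_eq (x := t.left) (y := t.right) h with ⟨h1, h2⟩ | ⟨h1, h2⟩
  · exact hne s t h1 h2
  · have := s.lt
    rw [h1, h2] at this
    exact absurd this (not_lt.2 t.lt.le)

/-- Affine coordinates in which a parallelogram becomes the unit square. -/
structure SquareCoords (a b c d : Plane) where
  X : Plane → ℝ
  Y : Plane → ℝ
  X_line : ∀ z v : Plane, ∀ m : ℝ, X (z + m • v) = X z + m * (X (z + v) - X z)
  Y_line : ∀ z v : Plane, ∀ m : ℝ, Y (z + m • v) = Y z + m * (Y (z + v) - Y z)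
  continuous_X : Continuous X
  continuous_Y : Continuous Y
  eq_a : ∀ z, z = a + X z • (b - a) + Y z • (d - a)
  Xa : X a = 0
  Ya : Y a = 0
  Xb : X b = 1
  Yb : Y b = 0
  Xc : X c = 1
  Yc : Y c = 1
  Xd : X d = 0
  Yd : Y d = 1

lemma IsFramed.exists_coords {a b c d : Plane} (h : IsFramed S a b c d) :
    Nonempty (SquareCoords a b c d) := by
  set K := cross (b - a) (d - a) with hK
  have hc : c = b + d - a := by rw [← h.parallelogram]; module
  have hK0 : K ≠ 0 := by
    intro h0
    have h1 := h.right_angle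
    -- Lagrange's identity: the product of the squared side lengths is the square of the dot product
    -- plus the square of the determinant.
    have h2 : ((b.1 - a.1) ^ 2 + (b.2 - a.2) ^ 2) * ((d.1 - a.1) ^ 2 + (d.2 - a.2) ^ 2) = 0 := by
      simp only [hK, cross, Prod.fst_sub, Prod.snd_sub] at h0
      linear_combination ((b.1 - a.1) * (d.1 - a.1) + (b.2 - a.2) * (d.2 - a.2)) * h1 +
        ((b.1 - a.1) * (d.2 - a.2) - (b.2 - a.2) * (d.1 - a.1)) * h0
    have key : ∀ x y : Plane, (y.1 - x.1) ^ 2 + (y.2 - x.2) ^ 2 = 0 → x = y := by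
      intro x y h
      ext
      · nlinarith [sq_nonneg (y.1 - x.1), sq_nonneg (y.2 - x.2)]
      · nlinarith [sq_nonneg (y.1 - x.1), sq_nonneg (y.2 - x.2)]
    rcases mul_eq_zero.1 h2 with h3 | h3
    · exact h.ne_left (key _ _ h3)
    · exact h.ne_right (key _ _ h3)
  exact ⟨{
    X := fun z => cross (z - a) (d - a) / K
    Y := fun z => cross (b - a) (z - a) / K
    X_line := by intro z v m; simp only [cross, Prod.fst_add, Prod.snd_add, Prod.smul_fst,
      Prod.smul_snd, Prod.fst_sub, Prod.snd_sub, smul_eq_mul]; ring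
    Y_line := by intro z v m; simp only [cross, Prod.fst_add, Prod.snd_add, Prod.smul_fst,
      Prod.smul_snd, Prod.fst_sub, Prod.snd_sub, smul_eq_mul]; ring
    continuous_X := by
      have : Continuous fun z : Plane => cross (z - a) (d - a) := by fun_prop
      exact this.div_const K
    continuous_Y := by
      have : Continuous fun z : Plane => cross (b - a) (z - a) := by fun_prop
      exact this.div_const K
    eq_a := by
      intro z
      have key : K • z = K • a + cross (z - a) (d - a) • (b - a) +
          cross (b - a) (z - a) • (d - a) := by
        simp only [hK, cross]
        ext <;> simp only [Prod.fst_add, Prod.snd_add, Prod.smul_fst,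
          Prod.smul_snd, Prod.fst_sub, Prod.snd_sub, smul_eq_mul] <;> ring
      have h1 : z = K⁻¹ • (K • a + cross (z - a) (d - a) • (b - a) +
          cross (b - a) (z - a) • (d - a)) := by rw [← key, inv_smul_smul₀ hK0]
      rw [smul_add, smul_add, inv_smul_smul₀ hK0, smul_smul, smul_smul, ← div_eq_inv_mul,
        ← div_eq_inv_mul] at h1
      exact h1
    Xa := by simp [cross]
    Ya := by simp [cross]
    Xb := by simp only [← hK]; exact div_self hK0
    Yb := by simp [cross_self]
    Xc := by
      have : c - a = (b - a) + (d - a) := by rw [hc]; module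
      simp only [this, cross_add_left, cross_self, add_zero, ← hK]; exact div_self hK0
    Yc := by
      have : c - a = (b - a) + (d - a) := by rw [hc]; module
      simp only [this, cross_add_right, cross_self, zero_add, ← hK]; exact div_self hK0
    Xd := by simp [cross_self]
    Yd := by simp only [← hK]; exact div_self hK0 }⟩

lemma subset_hull_of_mem_sides {a b c d : Plane} {A : Set Plane} (hA : A ∈ sides a b c d) :
    A ⊆ convexHull ℝ {a, b, c, d} := by
  have hsub := subset_convexHull ℝ ({a, b, c, d} : Set Plane)
  have hc := convex_convexHull ℝ ({a, b, c, d} : Set Plane)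
  rcases hA with rfl | rfl | rfl | rfl <;>
    exact hc.segment_subset (hsub (by simp)) (hsub (by simp))

namespace SquareCoords

variable {a b c d : Plane} (Q : SquareCoords a b c d)
include Q

lemma ext {z w : Plane} (hX : Q.X z = Q.X w) (hY : Q.Y z = Q.Y w) : z = w := by
  rw [Q.eq_a z, Q.eq_a w, hX, hY]

lemma mem_segment_iff_of_Y {x y : Plane} (hY : Q.Y y = Q.Y x) {i : ℝ} (hi : i = 1 ∨ i = -1)
    (hX : Q.X y - Q.X x = i) (z : Plane) :
    z ∈ segment ℝ x y ↔ Q.Y z = Q.Y x ∧ 0 ≤ (Q.X z - Q.X x) * i ∧ (Q.X z - Q.X x) * i ≤ 1 := by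
  have hi2 : i * i = 1 := by rcases hi with rfl | rfl <;> norm_num
  rw [segment_eq_image']
  have hx : ∀ l : ℝ, Q.X (x + l • (y - x)) = Q.X x + l * i := by
    intro l; rw [Q.X_line, add_sub_cancel, hX]
  have hy : ∀ l : ℝ, Q.Y (x + l • (y - x)) = Q.Y x := by
    intro l; rw [Q.Y_line, add_sub_cancel, hY]; ring
  constructor
  · rintro ⟨l, ⟨h0, h1⟩, rfl⟩
    simp only [hx, hy]
    have : (Q.X x + l * i - Q.X x) * i = l := by linear_combination l * hi2
    rw [this]
    exact ⟨trivial, h0, h1⟩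
  · rintro ⟨h, h0, h1⟩
    refine ⟨_, ⟨h0, h1⟩, Q.ext ?_ ?_⟩
    · simp only [hx]; linear_combination (Q.X z - Q.X x) * hi2
    · simp only [hy]; exact h.symm

lemma mem_segment_iff_of_X {x y : Plane} (hX : Q.X y = Q.X x) {i : ℝ} (hi : i = 1 ∨ i = -1)
    (hY : Q.Y y - Q.Y x = i) (z : Plane) :
    z ∈ segment ℝ x y ↔ Q.X z = Q.X x ∧ 0 ≤ (Q.Y z - Q.Y x) * i ∧ (Q.Y z - Q.Y x) * i ≤ 1 := by
  have hi2 : i * i = 1 := by rcases hi with rfl | rfl <;> norm_num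
  rw [segment_eq_image']
  have hx : ∀ l : ℝ, Q.Y (x + l • (y - x)) = Q.Y x + l * i := by
    intro l; rw [Q.Y_line, add_sub_cancel, hY]
  have hy : ∀ l : ℝ, Q.X (x + l • (y - x)) = Q.X x := by
    intro l; rw [Q.X_line, add_sub_cancel, hX]; ring
  constructor
  · rintro ⟨l, ⟨h0, h1⟩, rfl⟩
    simp only [hx, hy]
    have : (Q.Y x + l * i - Q.Y x) * i = l := by linear_combination l * hi2
    rw [this]
    exact ⟨trivial, h0, h1⟩
  · rintro ⟨h, h0, h1⟩
    refine ⟨_, ⟨h0, h1⟩, Q.ext ?_ ?_⟩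
    · simp only [hy]; exact h.symm
    · simp only [hx]; linear_combination (Q.Y z - Q.Y x) * hi2

lemma mem_ab (z : Plane) : z ∈ segment ℝ a b ↔ Q.Y z = 0 ∧ 0 ≤ Q.X z ∧ Q.X z ≤ 1 := by
  rw [Q.mem_segment_iff_of_Y (Q.Yb.trans Q.Ya.symm) (Or.inl rfl) (by rw [Q.Xa, Q.Xb]; norm_num),
    Q.Xa, Q.Ya, sub_zero, mul_one]

lemma mem_bc (z : Plane) : z ∈ segment ℝ b c ↔ Q.X z = 1 ∧ 0 ≤ Q.Y z ∧ Q.Y z ≤ 1 := by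
  rw [Q.mem_segment_iff_of_X (Q.Xc.trans Q.Xb.symm) (Or.inl rfl) (by rw [Q.Yb, Q.Yc]; norm_num),
    Q.Xb, Q.Yb, sub_zero, mul_one]

lemma mem_cd (z : Plane) : z ∈ segment ℝ c d ↔ Q.Y z = 1 ∧ 0 ≤ Q.X z ∧ Q.X z ≤ 1 := by
  rw [Q.mem_segment_iff_of_Y (Q.Yd.trans Q.Yc.symm) (Or.inr rfl) (by rw [Q.Xc, Q.Xd]; norm_num),
    Q.Xc, Q.Yc]
  constructor <;> rintro ⟨h, h0, h1⟩ <;> exact ⟨h, by linarith, by linarith⟩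

lemma mem_da (z : Plane) : z ∈ segment ℝ d a ↔ Q.X z = 0 ∧ 0 ≤ Q.Y z ∧ Q.Y z ≤ 1 := by
  rw [Q.mem_segment_iff_of_X (Q.Xa.trans Q.Xd.symm) (Or.inr rfl) (by rw [Q.Ya, Q.Yd]; norm_num),
    Q.Xd, Q.Yd]
  constructor <;> rintro ⟨h, h0, h1⟩ <;> exact ⟨h, by linarith, by linarith⟩

lemma mem_hull (z : Plane) : z ∈ convexHull ℝ {a, b, c, d} ↔
    (0 ≤ Q.X z ∧ Q.X z ≤ 1) ∧ 0 ≤ Q.Y z ∧ Q.Y z ≤ 1 := by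
  constructor
  · have hconv : Convex ℝ {z | (0 ≤ Q.X z ∧ Q.X z ≤ 1) ∧ 0 ≤ Q.Y z ∧ Q.Y z ≤ 1} := by
      rw [convex_iff_segment_subset]
      rintro x ⟨⟨hx0, hx1⟩, hy0, hy1⟩ y ⟨⟨hx0', hx1'⟩, hy0', hy1'⟩ z hz
      rw [segment_eq_image'] at hz
      obtain ⟨l, ⟨h0, h1⟩, rfl⟩ := hz
      simp only [mem_ofPred_eq, Q.X_line, Q.Y_line, add_sub_cancel]
      refine ⟨⟨?_, ?_⟩, ?_, ?_⟩ <;> nlinarith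
    refine fun hz => convexHull_min ?_ hconv hz
    rintro w (rfl | rfl | rfl | rfl)
    · simp [Q.Xa, Q.Ya]
    · simp [Q.Xb, Q.Yb]
    · simp [Q.Xc, Q.Yc]
    · simp [Q.Xd, Q.Yd]
  · rintro ⟨⟨hx0, hx1⟩, hy0, hy1⟩
    have hsub := subset_convexHull ℝ ({a, b, c, d} : Set Plane)
    have hc := convex_convexHull ℝ ({a, b, c, d} : Set Plane)
    have e1 : a + Q.X z • (b - a) ∈ segment ℝ a b := by
      rw [segment_eq_image']; exact ⟨_, ⟨hx0, hx1⟩, rfl⟩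
    have e2 : d + Q.X z • (c - d) ∈ segment ℝ d c := by
      rw [segment_eq_image']; exact ⟨_, ⟨hx0, hx1⟩, rfl⟩
    refine hc.segment_subset (hc.segment_subset (hsub (by simp)) (hsub (by simp)) e1)
      (hc.segment_subset (hsub (by simp)) (hsub (by simp)) e2) ?_
    rw [segment_eq_image']
    refine ⟨Q.Y z, ⟨hy0, hy1⟩, ?_⟩
    have hcd : c - d = b - a := by
      have h1 := Q.eq_a c
      rw [Q.Xc, Q.Yc] at h1
      rw [h1]; module
    conv_rhs => rw [Q.eq_a z]
    simp only [hcd]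
    module

lemma mem_interior_hull (z : Plane) : z ∈ interior (convexHull ℝ {a, b, c, d}) ↔
    (0 < Q.X z ∧ Q.X z < 1) ∧ 0 < Q.Y z ∧ Q.Y z < 1 := by
  constructor
  · intro hz
    set g : Plane := a + (1 / 2 : ℝ) • (c - a) with hg
    have hXg : Q.X g = 1 / 2 := by
      rw [hg, Q.X_line, add_sub_cancel, Q.Xa, Q.Xc]; norm_num
    have hYg : Q.Y g = 1 / 2 := by
      rw [hg, Q.Y_line, add_sub_cancel, Q.Ya, Q.Yc]; norm_num
    have hc : Continuous fun m : ℝ => z + m • (z - g) := by fun_prop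
    have h0 : ∀ᶠ m in 𝓝[>] (0 : ℝ), z + m • (z - g) ∈ interior (convexHull ℝ {a, b, c, d}) :=
      nhdsWithin_le_nhds (hc.continuousAt.eventually (isOpen_interior.mem_nhds (by simpa using hz)))
    obtain ⟨m, hm, hm0⟩ := (h0.and self_mem_nhdsWithin).exists
    have hm0 : 0 < m := hm0
    have hX := Q.X_line z (z - g) (-1)
    have hY := Q.Y_line z (z - g) (-1)
    have e : z + (-1 : ℝ) • (z - g) = g := by module
    rw [e] at hX hY
    have hm' := (Q.mem_hull _).1 (interior_subset hm)
    rw [Q.X_line, Q.Y_line] at hm'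
    obtain ⟨⟨h1, h2⟩, h3, h4⟩ := hm'
    have eX : Q.X (z + (z - g)) - Q.X z = Q.X z - 1 / 2 := by linarith
    have eY : Q.Y (z + (z - g)) - Q.Y z = Q.Y z - 1 / 2 := by linarith
    rw [eX] at h1 h2
    rw [eY] at h3 h4
    refine ⟨⟨?_, ?_⟩, ?_, ?_⟩ <;> nlinarith
  · rintro ⟨⟨hx0, hx1⟩, hy0, hy1⟩
    have hopen : IsOpen {z | (0 < Q.X z ∧ Q.X z < 1) ∧ 0 < Q.Y z ∧ Q.Y z < 1} := by
      have hX := Q.continuous_X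
      have hY := Q.continuous_Y
      exact ((isOpen_lt continuous_const hX).inter (isOpen_lt hX continuous_const)).inter
        ((isOpen_lt continuous_const hY).inter (isOpen_lt hY continuous_const))
    refine interior_maximal ?_ hopen ⟨⟨hx0, hx1⟩, hy0, hy1⟩
    rintro w ⟨⟨hx0, hx1⟩, hy0, hy1⟩
    exact (Q.mem_hull w).2 ⟨⟨hx0.le, hx1.le⟩, hy0.le, hy1.le⟩

lemma not_mem_interior_of_mem_sides {A : Set Plane} (hA : A ∈ sides a b c d) {z : Plane}
    (hz : z ∈ A) : z ∉ interior (convexHull ℝ {a, b, c, d}) := by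
  rw [Q.mem_interior_hull]
  rintro ⟨⟨h1, h2⟩, h3, h4⟩
  rcases hA with rfl | rfl | rfl | rfl
  · linarith [((Q.mem_ab z).1 hz).1]
  · linarith [((Q.mem_bc z).1 hz).1]
  · linarith [((Q.mem_cd z).1 hz).1]
  · linarith [((Q.mem_da z).1 hz).1]

/-- Two different sides meet at most in a common endpoint. -/
lemma endpoint_of_mem_sides {s t : Seg} (hs : s.carrier ∈ sides a b c d)
    (ht : t.carrier ∈ sides a b c d) (hst : s ≠ t) {z : Plane} (hzs : z ∈ s.carrier)
    (hzt : z ∈ t.carrier) : z = s.left ∨ z = s.right := by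
  have hne : s.carrier ≠ t.carrier := fun h => hst (Seg.carrier_injective h)
  have key : ∀ x y : Plane, s.carrier = segment ℝ x y → z = x ∨ z = y →
      z = s.left ∨ z = s.right := by
    intro x y h hz
    rcases Seg.ends_of_carrier_eq h with ⟨h1, h2⟩ | ⟨h1, h2⟩
    · rwa [h1, h2]
    · rw [h1, h2]; exact hz.symm
  have za : Q.X z = 0 → Q.Y z = 0 → z = a := fun h h' =>
    Q.ext (h.trans Q.Xa.symm) (h'.trans Q.Ya.symm)
  have zb : Q.X z = 1 → Q.Y z = 0 → z = b := fun h h' =>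
    Q.ext (h.trans Q.Xb.symm) (h'.trans Q.Yb.symm)
  have zc : Q.X z = 1 → Q.Y z = 1 → z = c := fun h h' =>
    Q.ext (h.trans Q.Xc.symm) (h'.trans Q.Yc.symm)
  have zd : Q.X z = 0 → Q.Y z = 1 → z = d := fun h h' =>
    Q.ext (h.trans Q.Xd.symm) (h'.trans Q.Yd.symm)
  -- Equal sides are excluded, adjacent sides determine a corner by their coordinates, and opposite
  -- sides give contradictory coordinates.
  rcases hs with hs | hs | hs | hs <;> rcases ht with ht | ht | ht | ht <;>
    first
    | exact absurd (hs.trans ht.symm) hne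
    | (refine key _ _ hs ?_
       rw [hs] at hzs
       rw [ht] at hzt
       simp only [Q.mem_ab, Q.mem_bc, Q.mem_cd, Q.mem_da] at hzs hzt
       first
       | exact Or.inl (za (by linarith) (by linarith))
       | exact Or.inr (za (by linarith) (by linarith))
       | exact Or.inl (zb (by linarith) (by linarith))
       | exact Or.inr (zb (by linarith) (by linarith))
       | exact Or.inl (zc (by linarith) (by linarith))
       | exact Or.inr (zc (by linarith) (by linarith))
       | exact Or.inl (zd (by linarith) (by linarith))
       | exact Or.inr (zd (by linarith) (by linarith)))

/-- The last point of the ray in the compact hull is not interior, so one of its coordinates is 0 or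
1, which puts it on a side. -/
lemma exists_hit_sides {z v : Plane} (hz : z ∈ interior (convexHull ℝ {a, b, c, d})) (hv : v ≠ 0) :
    ∃ m : ℝ, 0 < m ∧ ∃ A ∈ sides a b c d, z + m • v ∈ A := by
  set H : Set Plane := convexHull ℝ {a, b, c, d} with hH
  have hHc : IsCompact H := Set.Finite.isCompact_convexHull ℝ (Set.toFinite {a, b, c, d})
  have hcont : Continuous fun m : ℝ => z + m • v := by fun_prop
  obtain ⟨M, hM⟩ := hHc.isBounded.exists_norm_le
  have hv0 : 0 < ‖v‖ := norm_pos_iff.2 hv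
  have hbd : ∀ m : ℝ, 0 ≤ m → z + m • v ∈ H → m ≤ (M + ‖z‖) / ‖v‖ := by
    intro m hm0 hm
    rw [le_div_iff₀ hv0]
    have h1 : ‖m • v‖ ≤ ‖z + m • v‖ + ‖z‖ := by
      have : m • v = (z + m • v) - z := by module
      calc ‖m • v‖ = ‖(z + m • v) - z‖ := by rw [← this]
        _ ≤ _ := norm_sub_le _ _
    rw [norm_smul, Real.norm_of_nonneg hm0] at h1
    linarith [hM _ hm]
  have hC : IsCompact (Icc 0 ((M + ‖z‖) / ‖v‖) ∩ (fun m : ℝ => z + m • v) ⁻¹' H) :=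
    isCompact_Icc.inter_right (hHc.isClosed.preimage hcont)
  have h0 : z + (0 : ℝ) • v ∈ H := by simpa using interior_subset hz
  obtain ⟨m, ⟨hm, hmH⟩, hmax⟩ := hC.exists_isGreatest ⟨0, ⟨le_rfl, hbd 0 le_rfl h0⟩, h0⟩
  have hnot : z + m • v ∉ interior H := by
    intro hint
    have hev : ∀ᶠ m' in 𝓝[>] m, z + m' • v ∈ interior H :=
      nhdsWithin_le_nhds (hcont.continuousAt.eventually (isOpen_interior.mem_nhds hint))
    obtain ⟨m', hm', hlt⟩ := (hev.and self_mem_nhdsWithin).exists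
    have hlt : m < m' := hlt
    have h0' : 0 ≤ m' := hm.1.trans hlt.le
    have hmH' : z + m' • v ∈ H := interior_subset hm'
    exact absurd (hmax ⟨⟨h0', hbd m' h0' hmH'⟩, hmH'⟩) (not_le.2 hlt)
  have hm0 : 0 < m := by
    refine lt_of_le_of_ne hm.1 ?_
    rintro rfl
    rw [zero_smul, add_zero] at hnot
    exact hnot hz
  refine ⟨m, hm0, ?_⟩
  rw [hH, Q.mem_interior_hull] at hnot
  obtain ⟨⟨h1, h2⟩, h3, h4⟩ := (Q.mem_hull _).1 hmH
  by_cases k1 : Q.X (z + m • v) = 0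
  · exact ⟨_, Or.inr (Or.inr (Or.inr rfl)), (Q.mem_da _).2 ⟨k1, h3, h4⟩⟩
  by_cases k2 : Q.X (z + m • v) = 1
  · exact ⟨_, Or.inr (Or.inl rfl), (Q.mem_bc _).2 ⟨k2, h3, h4⟩⟩
  by_cases k3 : Q.Y (z + m • v) = 0
  · exact ⟨_, Or.inl rfl, (Q.mem_ab _).2 ⟨k3, h1, h2⟩⟩
  by_cases k4 : Q.Y (z + m • v) = 1
  · exact ⟨_, Or.inr (Or.inr (Or.inl rfl)), (Q.mem_cd _).2 ⟨k4, h1, h2⟩⟩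
  exact absurd ⟨⟨lt_of_le_of_ne h1 (Ne.symm k1), lt_of_le_of_ne h2 k2⟩,
    lt_of_le_of_ne h3 (Ne.symm k3), lt_of_le_of_ne h4 k4⟩ hnot

end SquareCoords

lemma IsFramed.frame {a b c d : Plane} (h : IsFramed S a b c d) :
    Frame S (convexHull ℝ {a, b, c, d}) := by
  obtain ⟨Q⟩ := h.exists_coords
  have hside : ∀ s ∈ S, s.carrier ∈ sides a b c d ∨
      s.carrier ⊆ interior (convexHull ℝ {a, b, c, d}) := fun s hs =>
    or_iff_not_imp_left.2 (h.inside s hs)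
  refine ⟨convex_convexHull _ _, ?_, ?_, ?_, ?_⟩
  · intro s hs
    rcases hside s hs with h1 | h1
    · exact subset_hull_of_mem_sides h1
    · exact h1.trans interior_subset
  · intro z hz v hv
    obtain ⟨m, hm, A, hA, hmA⟩ := Q.exists_hit_sides hz hv
    obtain ⟨s, hs, rfl⟩ := h.sides_mem A hA
    exact ⟨m, hm, s, hs, hmA⟩
  · intro s hs t ht hst z hzs hzt
    by_cases h1 : s.carrier ∈ sides a b c d
    · by_cases h2 : t.carrier ∈ sides a b c d
      · exact ⟨Q.not_mem_interior_of_mem_sides h1 hzs, Q.endpoint_of_mem_sides h1 h2 hst hzs hzt⟩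
      · exact absurd (h.inside t ht h2 hzt) (Q.not_mem_interior_of_mem_sides h1 hzs)
    · by_cases h2 : t.carrier ∈ sides a b c d
      · exact absurd (h.inside s hs h1 hzs) (Q.not_mem_interior_of_mem_sides h2 hzt)
      · exact absurd hzt (Set.disjoint_left.1 (h.disjoint s hs t ht h1 h2 hst) hzs)
  · intro s hs
    rcases hside s hs with h1 | h1
    · exact Or.inr (Set.disjoint_left.2 fun z hz => Q.not_mem_interior_of_mem_sides h1 hz)
    · exact Or.inl h1

/-! ### Counting -/

lemma Frame.exists_segVisible (F : Frame S R) {p : Plane} (hp : p ∈ interior R) :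
    ∃ s ∈ S, SegVisible S s p := by
  by_cases hpS : ∃ s ∈ S, p ∈ s.carrier
  · obtain ⟨s, hs, h⟩ := hpS
    exact ⟨s, hs, p, h, Or.inl rfl⟩
  · push Not at hpS
    obtain ⟨c₂, hc₂, f, hf, hhit⟩ := F.hit p hp (1, 0) (by simp)
    obtain ⟨c, -, -, ⟨t, ht, hct⟩, hv⟩ := exists_first_hit S (o := p) (v := (1, 0)) (c₁ := 0)
      le_rfl (fun c h1 h2 => absurd h1 (not_lt.2 h2.le)) (by simpa using hpS) hc₂.le ⟨f, hf, hhit⟩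
    exact ⟨t, ht, _, hct, hv⟩

/-- The visible point `y` of `s` is kept fixed and `p` moves. Only `s` itself could interfere, when
it is seen edge-on from `p`, and the arc immediately leaves the line of `s`. -/
lemma Frame.eventually_segVisible (F : Frame S R) {p : Plane} (hp : p ∈ interior R)
    (hpS : ∀ g ∈ S, p ∉ g.carrier) {s : Seg} (hs : s ∈ S) (hv : SegVisible S s p) :
    ∀ᶠ x in 𝓝[>] (0 : ℝ), SegVisible S s (arc p x) := by
  obtain ⟨y, hy, hv⟩ := hv
  have hpy : p ≠ y := fun h => hpS s hs (h ▸ hy)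
  have key : ∀ g ∈ S, ∀ᶠ x in 𝓝[>] (0 : ℝ), Disjoint (openSegment ℝ (arc p x) y) g.carrier := by
    intro g hg
    by_cases hgs : g = s
    · subst hgs
      obtain ⟨r, -, -, rfl⟩ := Seg.mem_carrier.1 hy
      have hd : g.dir ≠ 0 := fun h => g.dir_fst_pos.ne' (by rw [h]; rfl)
      filter_upwards [arc_avoids p g.left g.dir hd] with x hx
      exact disjoint_openSegment_self hx r
    rcases F.inside_or_disjoint g hg with hin | hdis
    · have hd : Disjoint (segment ℝ y p) g.carrier := by
        rw [Set.disjoint_left, segment_symm]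
        intro z hz hzg
        rw [← insert_endpoints_openSegment] at hz
        rcases hz with rfl | rfl | hz
        · exact hpS g hg hzg
        · exact (F.meet g hg s hs hgs _ hzg hy).1 (hin hzg)
        · exact hv.notMem hpy hz hg hzg
      refine ((tendsto_arc p).eventually (eventually_disjoint_segment g.isClosed_carrier hd)).mono ?_
      intro x hx
      rw [openSegment_symm]
      exact hx.mono_left (openSegment_subset_segment _ _ _)
    · filter_upwards [(tendsto_arc p).eventually (isOpen_interior.mem_nhds hp)] with x hx
      exact (hdis.mono_right (F.openSegment_subset hx (F.subset s hs hy))).symm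
  filter_upwards [(eventually_all_finset S).2 key] with x hx
  exact ⟨y, hy, Or.inr hx⟩

/-- `p` is in the triangle `Δ` of the covering of `s`, which corresponds to the visible part of `s`
that starts at the parameter `r`. -/
def CorrespondsTo (S : Finset Seg) (s : Seg) (ε : ℝ) (Δ : Set Plane) (p : Plane) (r : ℝ) : Prop :=
  (InitialAt S s ε Δ p ∧ r = 0) ∨ SweepAt S s ε Δ p r

lemma exists_correspondsTo {s : Seg} {Δ : Set Plane} (hΔ : Δ ∈ cover S s) {p : Plane}
    (hp : p ∈ interior Δ) :
    ∃ ε r : ℝ, (ε = 1 ∨ ε = -1) ∧ s.OnSide ε p ∧ CorrespondsTo S s ε Δ p r := by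
  have key : ∀ ε : ℝ, Δ ∈ initialTriangles S s ε ∪ sweepTriangles S s ε →
      ∃ r, s.OnSide ε p ∧ CorrespondsTo S s ε Δ p r := by
    rintro ε (h | h)
    · obtain ⟨h1, h2⟩ := initialAt_of_mem_interior h hp
      exact ⟨0, h1, Or.inl ⟨h2, rfl⟩⟩
    · obtain ⟨h1, r, h2⟩ := sweepAt_of_mem_interior h hp
      exact ⟨r, h1, Or.inr h2⟩
  rcases hΔ with h | h
  · obtain ⟨r, h⟩ := key 1 h
    exact ⟨1, r, Or.inl rfl, h⟩
  · obtain ⟨r, h⟩ := key (-1) h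
    exact ⟨-1, r, Or.inr rfl, h⟩

lemma CorrespondsTo.notMem {s : Seg} {ε : ℝ} {Δ : Set Plane} {p : Plane} {r : ℝ}
    (h : CorrespondsTo S s ε Δ p r) : ∀ g ∈ S, p ∉ g.carrier := fun g hg => by
  rcases h with ⟨h, -⟩ | h
  exacts [h.notMem hg, h.notMem hg]

lemma CorrespondsTo.exists_piece (F : Frame S R) {s : Seg} (hs : s ∈ S) {ε : ℝ} {Δ : Set Plane}
    {p : Plane} (hp : p ∈ interior R) {r : ℝ} (h : CorrespondsTo S s ε Δ p r)
    (hside : s.OnSide ε p) : ∃ b, IsMaxInterval (fun r => Visible S p (s.pt r)) r b := by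
  rcases h with ⟨h, rfl⟩ | h
  exacts [h.exists_piece F hs hp hside, h.exists_piece F hs hp hside]

/-- The two kinds of triangles cannot share a parameter: the point `s.pt r` is visible for an
initial triangle and hidden for a sweep triangle. -/
lemma CorrespondsTo.unique (F : Frame S R) {s : Seg} (hs : s ∈ S) {ε : ℝ} {Δ Δ' : Set Plane}
    {p : Plane} (hp : p ∈ interior R) {r : ℝ} (h : CorrespondsTo S s ε Δ p r)
    (h' : CorrespondsTo S s ε Δ' p r) : Δ = Δ' := by
  rcases h with ⟨h, rfl⟩ | h
  · rcases h' with ⟨h', -⟩ | h'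
    · exact h.unique F h'
    · exact absurd h.visible h'.not_visible
  · rcases h' with ⟨h', rfl⟩ | h'
    · exact absurd h'.visible h.not_visible
    · exact h.unique F hs hp h'

lemma Seg.OnSide.sign_unique {s : Seg} {ε ε' : ℝ} {p : Plane} (h : s.OnSide ε p)
    (h' : s.OnSide ε' p) (hε : ε = 1 ∨ ε = -1) (hε' : ε' = 1 ∨ ε' = -1) : ε = ε' := by
  rw [onSide_iff] at h h'
  rcases hε with rfl | rfl <;> rcases hε' with rfl | rfl <;> first | rfl | (exfalso; linarith)

/-- There is an injective map from the triangles that contain `p` to the endpoints that are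
visible from `p`. -/
lemma Frame.exists_endpoint_map (F : Frame S R) {p : Plane} (hp : p ∈ interior R)
    (hint : ∀ T ∈ trianglesAt S p, p ∈ interior T.2) :
    ∃ (f : Seg × Set Plane → Seg) (q : Seg × Set Plane → Plane),
      (∀ T ∈ trianglesAt S p, f T ∈ segmentsAt S p ∧ (q T = (f T).left ∨ q T = (f T).right)) ∧
      InjOn q (trianglesAt S p) := by
  have key : ∀ T : Seg × Set Plane, ∃ (g : Seg) (q : Plane), T ∈ trianglesAt S p →
      (g ∈ segmentsAt S p ∧ (q = g.left ∨ q = g.right)) ∧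
      ∃ ε r b : ℝ, (ε = 1 ∨ ε = -1) ∧ T.1.OnSide ε p ∧ CorrespondsTo S T.1 ε T.2 p r ∧
        IsMaxInterval (fun r => Visible S p (T.1.pt r)) r b ∧ StartsAt p T.1 r b q := by
    intro T
    by_cases hT : T ∈ trianglesAt S p
    · obtain ⟨ε, r, hε, hside, hc⟩ := exists_correspondsTo hT.1.2 (hint T hT)
      obtain ⟨b, hb⟩ := hc.exists_piece F hT.1.1 hp hside
      obtain ⟨q, ⟨g, hg, hqg⟩, hv, hst⟩ := F.exists_startsAt hp hc.notMem hT.1.1 hε hside hb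
      refine ⟨g, q, fun _ => ⟨⟨⟨hg, q, ?_, hv⟩, hqg⟩, ε, r, b, hε, hside, hc, hb, hst⟩⟩
      rcases hqg with rfl | rfl
      exacts [g.left_mem, g.right_mem]
    · exact ⟨T.1, 0, fun h => absurd h hT⟩
  choose f q hfq using key
  refine ⟨f, q, fun T hT => (hfq T hT).1, fun T hT T' hT' he => ?_⟩
  obtain ⟨-, ε, r, b, hε, hside, hc, hb, hst⟩ := hfq T hT
  obtain ⟨-, ε', r', b', hε', hside', hc', hb', hst'⟩ := hfq T' hT'
  rw [← he] at hst'
  obtain ⟨s, Δ⟩ := T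
  obtain ⟨s', Δ'⟩ := T'
  simp only at hside hc hb hst hside' hc' hb' hst'
  obtain ⟨rfl, rfl⟩ := hst.unique F hT.1.1 hT'.1.1 hst' hb hb'
  obtain rfl := hside.sign_unique hside' hε hε'
  rw [hc.unique F hT.1.1 hp hc']

end SegVis

theorem mainTheorem1 (S : Finset SegVis.Seg) (a b c d : SegVis.Plane)
    (hS : SegVis.IsFramed S a b c d) (p : SegVis.Plane)
    (hp : p ∈ interior (convexHull ℝ {a, b, c, d}))
    (hbd : ∀ T ∈ SegVis.coverFamily S, p ∉ frontier T.2) :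
    (SegVis.segmentsAt S p).encard ≤ (SegVis.trianglesAt S p).encard ∧
    (SegVis.trianglesAt S p).encard ≤ 2 * (SegVis.segmentsAt S p).encard ∧
    ∃ f : SegVis.Seg × Set SegVis.Plane → SegVis.Seg,
      Set.MapsTo f (SegVis.trianglesAt S p) (SegVis.segmentsAt S p) ∧
      ∀ s ∈ SegVis.segmentsAt S p, {T ∈ SegVis.trianglesAt S p | f T = s}.encard ≤ 2 := by
  have F := hS.frame
  have hint : ∀ T ∈ SegVis.trianglesAt S p, p ∈ interior T.2 := by
    intro T hT
    by_contra h
    exact hbd T hT.1 ⟨subset_closure hT.2, h⟩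
  obtain ⟨f, q, hf, hq⟩ := F.exists_endpoint_map hp hint
  refine ⟨?_, ?_, f, fun T hT => (hf T hT).1, ?_⟩
  -- Some element is visible from points of the arc arbitrarily close to `p`, so some triangle
  -- contains `p`, necessarily in its interior, and such a point lies on no element of `S`.
  · have hpS : ∀ g ∈ S, p ∉ g.carrier := by
      have hfr : ∃ s ∈ S, ∃ᶠ x in 𝓝[>] (0 : ℝ), SegVis.SegVisible S s (SegVis.arc p x) := by
        by_contra hcon
        push Not at hcon
        have h1 := (eventually_all_finset S).2 hcon
        obtain ⟨x, hx, hxR⟩ := (h1.and ((SegVis.tendsto_arc p).eventually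
          (isOpen_interior.mem_nhds hp))).exists
        obtain ⟨s, hs, hv⟩ := F.exists_segVisible hxR
        exact hx s hs hv
      obtain ⟨s, hs, hv⟩ := hfr
      obtain ⟨Δ, hΔ, hpΔ⟩ := F.exists_triangle hp hs hv
      obtain ⟨ε, r, -, -, hc⟩ := SegVis.exists_correspondsTo hΔ (hint (s, Δ) ⟨⟨hs, hΔ⟩, hpΔ⟩)
      exact hc.notMem
    have hsub : SegVis.segmentsAt S p ⊆ Prod.fst '' SegVis.trianglesAt S p := by
      rintro s ⟨hs, hv⟩
      obtain ⟨Δ, hΔ, hpΔ⟩ := F.exists_triangle hp hs (F.eventually_segVisible hp hpS hs hv).frequently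
      exact ⟨(s, Δ), ⟨⟨hs, hΔ⟩, hpΔ⟩, rfl⟩
    exact (Set.encard_le_encard hsub).trans (Set.encard_image_le _ _)
  · classical
    -- A segment and one bit, saying whether the endpoint is the left one, encode the endpoint `q
    -- T`; this yields the factor 2.
    have hinj : Set.InjOn (fun T => (f T, decide (q T = (f T).left))) (SegVis.trianglesAt S p) := by
      intro T hT T' hT' h
      simp only [Prod.mk.injEq, decide_eq_decide] at h
      refine hq hT hT' ?_
      by_cases hl : q T = (f T).left
      · rw [hl, h.2.1 hl, h.1]
      · rw [(hf T hT).2.resolve_left hl, (hf T' hT').2.resolve_left fun h' => hl (h.2.2 h'), h.1]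
    have hmaps : Set.MapsTo (fun T => (f T, decide (q T = (f T).left))) (SegVis.trianglesAt S p)
        (SegVis.segmentsAt S p ×ˢ (Set.univ : Set Bool)) := fun T hT => ⟨(hf T hT).1, trivial⟩
    have h1 := Set.encard_le_encard_of_injOn hmaps hinj
    rw [Set.encard_prod, Set.encard_univ, mul_comm] at h1
    simpa using h1
  · intro s _
    have hmaps : Set.MapsTo q {T ∈ SegVis.trianglesAt S p | f T = s} {s.left, s.right} := by
      rintro T ⟨hT, rfl⟩
      exact (hf T hT).2
    exact (Set.encard_le_encard_of_injOn hmaps (hq.mono fun T hT => hT.1)).trans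
      (Set.encard_insert_le _ _ |>.trans (by rw [Set.encard_singleton]; norm_num))
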